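/- Let $X\in\mathbb C^{I_1\times\cdots\times I_d}$ be a tensor with mode-$n$ unfoldings $X_{(n)}\in\mathbb C^{I_n\times\prod_{j\ne n}I_j}$, let $\|X\|_F$ be its Frobenius norm, and let $\sigma_1(A)\ge\sigma_2(A)\ge\cdots$ denote the singular values of a matrix $A$. Let $r_1,\dots,r_d\ge 0$ be integers, $0<\delta<1$, $\beta\in(0,1]$, $\varepsilon>0$, and put $\eta=1+\sqrt{(8/\beta)\log(1/\delta)}$. For each mode $n$ let $c_n$ be an integer with $$c_n\ \ge\ \frac{4\eta^2 r_n}{\beta\varepsilon^2},$$ and let $p^{(n)}$ be a probability distribution on the columns of $X_{(n)}$ with $p^{(n)}_k\ \ge\ \beta\,\|X_{(n)}e_k\|_2^2/\|X\|_F^2$ for every $k$ (no condition if $X=0$); for $\beta=1$ and $X\neq0$ these are exactly the column-norm probabilities. For each $n$ draw $c_n$ columns of $X_{(n)}$ from $p^{(n)}$, either successively without replacement (each draw picks a column not drawn before, with probability proportional to $p^{(n)}$ among the remaining columns; if all columns of positive probability have already been drawn, the remaining draws are arbitrary distinct columns), or independently with replacement. No assumption is made on the dependence between different modes. Let $C_n\in\mathbb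 C^{I_n\times c_n}$ be the matrix of the drawn columns, $C_n^\dagger$ its Moore–Penrose pseudo-inverse, and $G=X\times_1C_1^\dagger\times_2\cdots\times_dC_d^\dagger$ the core tensor. Then, with probability of failure at most $d\delta$, $$\|X-G\times_1C_1\times_2\cdots\times_dC_d\|_F^2\ \le\ \sum_{n=1}^d\Big(\sum_{k>r_n}\sigma_k^2(X_{(n)})\Big)+d\,\varepsilon\,\|X\|_F^2 .$$ -/

import Mathlib

open scoped Matrix

namespace HOID

/-- Complex tensors of order `d` and size `I 0 × ⋯ × I (d - 1)`, as arrays of entries. -/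
abbrev Tensor {d : ℕ} (I : Fin d → ℕ) : Type := ((n : Fin d) → Fin (I n)) → ℂ

/-- The Frobenius norm of a tensor. -/
noncomputable def frob {d : ℕ} {I : Fin d → ℕ} (X : Tensor I) : ℝ :=
  √(∑ i, ‖X i‖ ^ 2)

/-- Column indices of the mode-`n` unfolding: one index for every mode other than `n`. -/
abbrev Col {d : ℕ} (I : Fin d → ℕ) (n : Fin d) : Type :=
  (j : {j : Fin d // j ≠ n}) → Fin (I j)

/-- The mode-`n` unfolding `X₍ₙ₎`: its rows are indexed by the `n`-th tensor index and its columns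
by the tuple of the remaining indices. -/
def unfold {d : ℕ} {I : Fin d → ℕ} (X : Tensor I) (n : Fin d) :
    Matrix (Fin (I n)) (Col I n) ℂ :=
  Matrix.of fun i j => X ((Equiv.piSplitAt n fun k => Fin (I k)).symm (i, j))

/-- The product `X ×₁ U₁ ×₂ ⋯ ×_d U_d` of a tensor with one matrix in every mode; its entry at `i` is
`∑ x_{j₁,…,j_d} (U₁)_{i₁ j₁} ⋯ (U_d)_{i_d j_d}`, the sum being over `j₁, …, j_d`. -/
noncomputable def modeProducts {d : ℕ} {I J : Fin d → ℕ} (X : Tensor I)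
    (U : (n : Fin d) → Matrix (Fin (J n)) (Fin (I n)) ℂ) : Tensor J :=
  fun i => ∑ j : (n : Fin d) → Fin (I n), X j * ∏ n, U n (i n) (j n)

/-- Successive products in the same modes: `(X ×ₙ U) ×ₙ V = X ×ₙ (V U)`. -/
theorem modeProducts_modeProducts {d : ℕ} {I J K : Fin d → ℕ} (X : Tensor I)
    (U : (n : Fin d) → Matrix (Fin (J n)) (Fin (I n)) ℂ)
    (V : (n : Fin d) → Matrix (Fin (K n)) (Fin (J n)) ℂ) :
    modeProducts (modeProducts X U) V = modeProducts X fun n => V n * U n := by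
  funext i
  simp only [modeProducts, Matrix.mul_apply, Finset.prod_univ_sum, Fintype.piFinset_univ,
    Finset.sum_mul, Finset.mul_sum, Finset.prod_mul_distrib]
  rw [Finset.sum_comm]
  exact Finset.sum_congr rfl fun j _ => Finset.sum_congr rfl fun k _ => by ring

/-- The products in terms of unfoldings: mode `n` multiplies `X₍ₙ₎` by `Uₙ` from the left and the
other modes act on its columns. With identity matrices in the other modes this reads
`(X ×ₙ Uₙ)₍ₙ₎ = Uₙ X₍ₙ₎`. -/
theorem unfold_modeProducts {d : ℕ} {I J : Fin d → ℕ} (X : Tensor I)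
    (U : (n : Fin d) → Matrix (Fin (J n)) (Fin (I n)) ℂ) (n : Fin d) :
    unfold (modeProducts X U) n = U n * unfold X n *
      Matrix.of fun (j : Col I n) (i : Col J n) =>
        ∏ m : {j : Fin d // j ≠ n}, U m (i m) (j m) := by
  ext a b
  simp only [unfold, modeProducts, Matrix.of_apply, Matrix.mul_apply, Finset.sum_mul]
  rw [← Equiv.sum_comp (Equiv.piSplitAt n fun k => Fin (I k)).symm, Fintype.sum_prod_type,
    Finset.sum_comm]
  refine Finset.sum_congr rfl fun y _ => Finset.sum_congr rfl fun x _ => ?_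
  have h : ∏ m, U m ((Equiv.piSplitAt n fun k => Fin (J k)).symm (a, b) m)
      ((Equiv.piSplitAt n fun k => Fin (I k)).symm (x, y) m) =
      U n a x * ∏ m : {j : Fin d // j ≠ n}, U m (b m) (y m) := by
    rw [Fintype.prod_eq_mul_prod_subtype_ne _ n]
    congr 1
    · simp [Equiv.piSplitAt]
    · refine Finset.prod_congr rfl fun m _ => ?_
      simp [Equiv.piSplitAt, m.2]
  rw [h]
  ring

/-- The Moore–Penrose pseudo-inverse `A† = (Aᴴ A)† Aᴴ`, where the pseudo-inverse of the Hermitian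
matrix `Aᴴ A` is obtained from a spectral decomposition by inverting the nonzero eigenvalues
(in `ℝ`, `0⁻¹ = 0`). -/
noncomputable def pinv {m n : Type*} [Fintype m] [Fintype n] [DecidableEq n]
    (A : Matrix m n ℂ) : Matrix n m ℂ :=
  (Matrix.isHermitian_conjTranspose_mul_self A).eigenvectorUnitary.val *
    Matrix.diagonal (fun k =>
      (((Matrix.isHermitian_conjTranspose_mul_self A).eigenvalues k)⁻¹ : ℝ) : n → ℂ) *
    (Matrix.isHermitian_conjTranspose_mul_self A).eigenvectorUnitary.valᴴ * Aᴴ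

open scoped ComplexOrder in
/-- `pinv A` satisfies the four Penrose conditions, which determine the pseudo-inverse. -/
theorem pinv_spec {m n : Type*} [Fintype m] [Fintype n] [DecidableEq n] (A : Matrix m n ℂ) :
    A * pinv A * A = A ∧ pinv A * A * pinv A = pinv A ∧
      (A * pinv A)ᴴ = A * pinv A ∧ (pinv A * A)ᴴ = pinv A * A := by
  have hH := Matrix.isHermitian_conjTranspose_mul_self A
  obtain ⟨P, hPd, hPH, hMPM, hPMP, hcomm⟩ : ∃ P : Matrix n n ℂ, pinv A = P * Aᴴ ∧ Pᴴ = P ∧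
      (Aᴴ * A) * P * (Aᴴ * A) = Aᴴ * A ∧ P * (Aᴴ * A) * P = P ∧
      P * (Aᴴ * A) = (Aᴴ * A) * P := by
    have hVV : hH.eigenvectorUnitary.valᴴ * hH.eigenvectorUnitary.val = 1 :=
      Matrix.mem_unitaryGroup_iff'.1 hH.eigenvectorUnitary.2
    have hspec : Aᴴ * A = hH.eigenvectorUnitary.val *
        Matrix.diagonal (fun k => ((hH.eigenvalues k : ℝ) : ℂ)) *
          hH.eigenvectorUnitary.valᴴ := by
      conv_lhs => rw [hH.spectral_theorem]
      rfl
    have hpin : pinv A = hH.eigenvectorUnitary.val *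
        Matrix.diagonal (fun k => (((hH.eigenvalues k)⁻¹ : ℝ) : ℂ)) *
          hH.eigenvectorUnitary.valᴴ * Aᴴ := rfl
    generalize hH.eigenvectorUnitary.val = V at hVV hspec hpin
    generalize hH.eigenvalues = e at hspec hpin
    have key : ∀ X Y : Matrix n n ℂ, (V * X * Vᴴ) * (V * Y * Vᴴ) = V * (X * Y) * Vᴴ := by
      intro X Y
      calc (V * X * Vᴴ) * (V * Y * Vᴴ) = V * X * (Vᴴ * V) * Y * Vᴴ := by
            simp only [Matrix.mul_assoc]
        _ = _ := by rw [hVV]; simp only [Matrix.mul_assoc, Matrix.one_mul]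
    refine ⟨_, hpin, ?_, ?_, ?_, ?_⟩
    · simp only [Matrix.conjTranspose_mul, Matrix.conjTranspose_conjTranspose,
        Matrix.diagonal_conjTranspose, Matrix.mul_assoc]
      congr 3
      ext k
      simp
    · rw [hspec, key, key, Matrix.diagonal_mul_diagonal, Matrix.diagonal_mul_diagonal]
      congr 3
      ext k
      by_cases h : e k = 0 <;> simp [h]
    · rw [hspec, key, key, Matrix.diagonal_mul_diagonal, Matrix.diagonal_mul_diagonal]
      congr 3
      ext k
      by_cases h : e k = 0 <;> simp [h]
    · rw [hspec, key, key, Matrix.diagonal_mul_diagonal, Matrix.diagonal_mul_diagonal]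
      congr 3
      ext k
      exact mul_comm _ _
  rw [hPd]
  refine ⟨?_, ?_, ?_, ?_⟩
  · have hB : (A * (P * (Aᴴ * A)) - A)ᴴ * (A * (P * (Aᴴ * A)) - A) = 0 := by
      have h1 : (A * (P * (Aᴴ * A)) - A)ᴴ = (Aᴴ * A) * P * Aᴴ - Aᴴ := by
        simp only [Matrix.conjTranspose_sub, Matrix.conjTranspose_mul,
          Matrix.conjTranspose_conjTranspose, hPH, Matrix.mul_assoc]
      have h2 : ((Aᴴ * A) * P * Aᴴ - Aᴴ) * A = 0 := by
        rw [Matrix.sub_mul, Matrix.mul_assoc _ Aᴴ A, hMPM, sub_self]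
      have h3 : A * (P * (Aᴴ * A)) - A = A * (P * (Aᴴ * A) - 1) := by
        rw [Matrix.mul_sub, Matrix.mul_one]
      rw [h1, h3, ← Matrix.mul_assoc, h2, Matrix.zero_mul]
    rw [Matrix.conjTranspose_mul_self_eq_zero, sub_eq_zero] at hB
    simpa only [Matrix.mul_assoc] using hB
  · have := congrArg (· * Aᴴ) hPMP
    simpa only [Matrix.mul_assoc] using this
  · simp only [Matrix.conjTranspose_mul, Matrix.conjTranspose_conjTranspose, hPH,
      Matrix.mul_assoc]
  · rw [Matrix.mul_assoc, Matrix.conjTranspose_mul, hPH, hH.eq, hcomm]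

/-- The core tensor `G = X ×₁ C₁† ×₂ ⋯ ×_d C_d†`. -/
noncomputable def coreTensor {d : ℕ} {I c : Fin d → ℕ} (X : Tensor I)
    (C : (n : Fin d) → Matrix (Fin (I n)) (Fin (c n)) ℂ) : Tensor c :=
  modeProducts X fun n => pinv (C n)

/-- `∑_{k > r} σ_k(A)²`. Mathlib numbers the singular values from `0`, so the sum starts at index
`r`; singular values with index at least the number of rows vanish. -/
noncomputable def tailSq {a : ℕ} {κ : Type*} [Fintype κ] [DecidableEq κ]
    (A : Matrix (Fin a) κ ℂ) (r : ℕ) : ℝ :=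
  ∑ k ∈ Finset.Ico r a, (Matrix.toEuclideanLin A).singularValues k ^ 2

/-- `p` is a probability distribution on the columns of `A` with
`p_k ≥ β ‖A e_k‖² / ‖A‖_F²` for all `k`. -/
structure IsColumnNormDistribution {a : ℕ} {κ : Type*} [Fintype κ]
    (β : ℝ) (A : Matrix (Fin a) κ ℂ) (p : κ → ℝ) : Prop where
  nonneg : ∀ k, 0 ≤ p k
  sum_eq_one : ∑ k, p k = 1
  lower_bound : ∀ k, β * ((∑ i, ‖A i k‖ ^ 2) / ∑ i, ∑ l, ‖A i l‖ ^ 2) ≤ p k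

/-- The draws `S 0, …, S (c - 1)` are independent and each has distribution `p`
(sampling with replacement). -/
structure SampledWithReplacement {Ω κ : Type*} [MeasurableSpace Ω] [MeasurableSpace κ]
    (μ : MeasureTheory.Measure Ω) (p : κ → ℝ) {c : ℕ} (S : Fin c → Ω → κ) : Prop where
  indep : ProbabilityTheory.iIndepFun S μ
  law : ∀ t k, μ.real {ω | S t ω = k} = p k

/-- Successive sampling without replacement from `p`: the draws are almost surely distinct, and,
given the earlier draws `s₀, …, s_{t-1}`, a not yet drawn `k` is drawn next with probability
`p_k / (1 - ∑_{u < t} p_{s_u})`. The denominators are cleared: once the whole support of `p` has been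
drawn, the condition leaves the choice among the remaining elements free. -/
structure SampledWithoutReplacement {Ω κ : Type*} [MeasurableSpace Ω]
    (μ : MeasureTheory.Measure Ω) (p : κ → ℝ) {c : ℕ} (S : Fin c → Ω → κ) : Prop where
  distinct : ∀ᵐ ω ∂μ, Function.Injective fun t => S t ω
  law : ∀ (t : Fin c) (s : Fin c → κ), (∀ u < t, s u ≠ s t) →
    μ.real {ω | ∀ u ≤ t, S u ω = s u} * (1 - ∑ u ∈ Finset.univ.filter (· < t), p (s u)) =
      μ.real {ω | ∀ u < t, S u ω = s u} * p (s t)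

/-- The matrix of the columns of `A` with indices `s 0, …, s (c - 1)`. -/
def columns {a c : ℕ} {κ : Type*} (A : Matrix (Fin a) κ ℂ) (s : Fin c → κ) :
    Matrix (Fin a) (Fin c) ℂ :=
  A.submatrix id s

end HOID

/-!
Since products in the same modes compose, `G ×₁ C₁ ⋯ ×_d C_d` is `X` multiplied in every mode `n` by
the orthogonal projection `Pₙ = Cₙ Cₙ†` onto the span of the drawn columns. Projecting one mode at a
time and using Pythagoras, the squared error is at most `∑ₙ ‖X₍ₙ₎ - Pₙ X₍ₙ₎‖²`
(`frob_sub_modeProducts_sq_le`). A union bound over the modes, which needs nothing about their joint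
law, leaves one matrix `A` with `c` sampled columns: with probability at least `1 - δ`,
`‖A - P A‖² ≤ ∑_{k > r} σ_k² + ε ‖A‖²` (`IsColumnNormDistribution.measureReal_not_sqNorm_le`).

*Linear algebra.* Let `N = (1/c) ∑ₜ a_{sₜ} a_{sₜ}ᴴ / p_{sₜ}`, an unbiased estimate of `A Aᴴ` built from
the drawn columns `a_{sₜ}`. If `U` is the projection onto the span of the top `r` left singular
vectors, then `tr (U A Aᴴ) ≤ tr (P A Aᴴ) + 2 √r ‖A Aᴴ - N‖`, because `N = P N P` allows `U` to be
replaced by `P U P` in `tr (U N)`. Hence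
`‖A - P A‖² ≤ ∑_{k > r} σ_k² + 2 √r ‖A Aᴴ - N‖` (`sqNorm_sub_le_of_approx`,
`exists_isProj_sqNorm_sub_le_tailSq`).

*Independent draws.* The summands of `N` have norm at most `‖A‖² / β` before averaging and mean norm
at most `‖A‖²`, so `‖A Aᴴ - N‖` has mean at most `‖A‖² / √(β c)` by a variance computation, and
changes by at most `2 ‖A‖² / (β c)` when one draw changes. McDiarmid's inequality gives
`‖A Aᴴ - N‖ ≤ η ‖A‖² / √(β c)` outside probability `δ` (`expect_indicator_norm_sum_le`), and the lower
bound on `c` turns `2 √r` times this into `ε ‖A‖²`.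

*Draws without replacement.* The residual of the projection depends only on the set of drawn columns
and decreases as this set grows. Replacing the draws one at a time, from the last to the first, by
independent ones, which may repeat earlier columns, can therefore only increase the probability of a
large residual (`SampledWithoutReplacement.measureReal_le_expect`), so the bound for independent draws
applies.
-/

namespace HOID

/-! ### Frobenius norms, projections and low-rank approximation -/

/-- The squared Frobenius norm of a matrix. -/
noncomputable def sqNorm {m n : Type*} [Fintype m] [Fintype n] (A : Matrix m n ℂ) : ℝ :=
  ∑ i, ∑ j, ‖A i j‖ ^ 2

section SqNorm

variable {m n l : Type*} [Fintype m] [Fintype n] [Fintype l]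

theorem sqNorm_nonneg (A : Matrix m n ℂ) : 0 ≤ sqNorm A := by
  unfold sqNorm; positivity

theorem sqNorm_conjTranspose (A : Matrix m n ℂ) : sqNorm Aᴴ = sqNorm A := by
  unfold sqNorm
  rw [Finset.sum_comm]
  simp [Matrix.conjTranspose_apply]

theorem sqNorm_eq_re_trace (A : Matrix m n ℂ) : sqNorm A = (A * Aᴴ).trace.re := by
  simp only [sqNorm, Matrix.trace, Matrix.diag_apply, Matrix.mul_apply,
    Matrix.conjTranspose_apply, Complex.re_sum]
  refine Finset.sum_congr rfl fun i _ => Finset.sum_congr rfl fun j _ => ?_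
  rw [Complex.star_def, Complex.mul_conj, Complex.normSq_eq_norm_sq, Complex.ofReal_re]

theorem sqNorm_mul_unitary [DecidableEq n] (A : Matrix m n ℂ) (V : Matrix n l ℂ)
    (hV : V * Vᴴ = 1) : sqNorm (A * V) = sqNorm A := by
  rw [sqNorm_eq_re_trace, sqNorm_eq_re_trace, Matrix.conjTranspose_mul, Matrix.mul_assoc,
    ← Matrix.mul_assoc V, hV, Matrix.one_mul]

/-- Cauchy–Schwarz for the trace pairing. -/
theorem abs_re_trace_mul_le (A : Matrix m n ℂ) (B : Matrix n m ℂ) :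
    |(A * B).trace.re| ≤ √(sqNorm A) * √(sqNorm B) := by
  have h1 : |(A * B).trace.re| ≤ ∑ q : m × n, ‖A q.1 q.2‖ * ‖B q.2 q.1‖ := by
    refine (Complex.abs_re_le_norm _).trans ?_
    simp only [Matrix.trace, Matrix.diag_apply, Matrix.mul_apply, Fintype.sum_prod_type]
    refine (norm_sum_le _ _).trans (Finset.sum_le_sum fun i _ => (norm_sum_le _ _).trans ?_)
    exact Finset.sum_le_sum fun j _ => (norm_mul _ _).le
  refine h1.trans ((Real.sum_mul_le_sqrt_mul_sqrt _ _ _).trans (le_of_eq ?_))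
  congr 2
  · rw [Fintype.sum_prod_type]; rfl
  · rw [Fintype.sum_prod_type, Finset.sum_comm]; rfl

/-- An orthogonal projection, as a matrix. -/
structure IsProj (P : Matrix m m ℂ) : Prop where
  herm : Pᴴ = P
  idem : P * P = P

variable {P : Matrix m m ℂ}

/-- Pythagoras: `A - P B` splits into `A - P A`, with columns in the kernel of `P`, and
`P (A - B)`, with columns in its range. -/
theorem IsProj.sqNorm_sub_mul (hP : IsProj P) (A B : Matrix m n ℂ) :
    sqNorm (A - P * B) = sqNorm (A - P * A) + sqNorm (P * (A - B)) := by
  have hsplit : A - P * B = (A - P * A) + P * (A - B) := by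
    rw [Matrix.mul_sub]; abel
  have h0 : P * (A - P * A) = 0 := by
    rw [Matrix.mul_sub, ← Matrix.mul_assoc, hP.idem, sub_self]
  have hx : (P * (A - B)) * (A - P * A)ᴴ = P * ((A - B) * (A - P * A)ᴴ) := Matrix.mul_assoc _ _ _
  have hx2 : ((P * (A - B)) * (A - P * A)ᴴ).trace = 0 := by
    rw [hx, Matrix.trace_mul_comm, Matrix.mul_assoc]
    have : (A - P * A)ᴴ * P = 0 := by
      have := congrArg Matrix.conjTranspose h0
      rwa [Matrix.conjTranspose_mul, hP.herm, Matrix.conjTranspose_zero] at this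
    rw [this, Matrix.mul_zero, Matrix.trace_zero]
  have hx3 : ((A - P * A) * (P * (A - B))ᴴ).trace = 0 := by
    have := congrArg star hx2
    rwa [← Matrix.trace_conjTranspose, Matrix.conjTranspose_mul, Matrix.conjTranspose_conjTranspose,
      star_zero] at this
  rw [hsplit, sqNorm_eq_re_trace, sqNorm_eq_re_trace, sqNorm_eq_re_trace, Matrix.conjTranspose_add,
    Matrix.add_mul, Matrix.mul_add, Matrix.mul_add, Matrix.trace_add, Matrix.trace_add,
    Matrix.trace_add, hx2, hx3]
  simp

theorem IsProj.sqNorm_sub (hP : IsProj P) (A : Matrix m n ℂ) :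
    sqNorm (A - P * A) = sqNorm A - sqNorm (P * A) := by
  have := hP.sqNorm_sub_mul A 0
  rw [Matrix.mul_zero, sub_zero] at this
  linarith

theorem IsProj.sqNorm_mul_le (hP : IsProj P) (A : Matrix m n ℂ) :
    sqNorm (P * A) ≤ sqNorm A := by
  linarith [hP.sqNorm_sub A, sqNorm_nonneg (A - P * A)]

theorem IsProj.sqNorm_sub_mul_le (hP : IsProj P) (A B : Matrix m n ℂ) :
    sqNorm (A - P * B) ≤ sqNorm (A - P * A) + sqNorm (A - B) := by
  rw [hP.sqNorm_sub_mul]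
  linarith [hP.sqNorm_mul_le (A - B)]

/-- `P A` is the best approximation of `A` with columns in the range of `P`. -/
theorem IsProj.sqNorm_sub_mul_le_of_mul_eq (hP : IsProj P) (A : Matrix m n ℂ) {B : Matrix m n ℂ}
    (hB : P * B = B) : sqNorm (A - P * A) ≤ sqNorm (A - B) := by
  have := hP.sqNorm_sub_mul A B
  rw [hB] at this
  linarith [sqNorm_nonneg (P * (A - B))]

theorem IsProj.sqNorm_eq (hP : IsProj P) : sqNorm P = P.trace.re := by
  rw [sqNorm_eq_re_trace, hP.herm, hP.idem]

theorem IsProj.re_apply_self_le_one (hP : IsProj P) (i : m) : (P i i).re ≤ 1 := by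
  have h : (P i i).re = ∑ j, ‖P i j‖ ^ 2 := by
    conv_lhs => rw [← hP.idem]
    rw [Matrix.mul_apply, Complex.re_sum]
    refine Finset.sum_congr rfl fun j _ => ?_
    have : P j i = star (P i j) := by
      conv_lhs => rw [← hP.herm]
      rfl
    rw [this, Complex.star_def, Complex.mul_conj, Complex.normSq_eq_norm_sq, Complex.ofReal_re]
  have h2 : ‖P i i‖ ^ 2 ≤ (P i i).re := by
    rw [h]
    exact Finset.single_le_sum (f := fun j => ‖P i j‖ ^ 2) (fun j _ => by positivity)
      (Finset.mem_univ i)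
  have h3 := Complex.re_le_norm (P i i)
  nlinarith [norm_nonneg (P i i)]

theorem isProj_mul_pinv [DecidableEq n] (A : Matrix m n ℂ) : IsProj (A * pinv A) where
  herm := (pinv_spec A).2.2.1
  idem := by rw [← Matrix.mul_assoc, (pinv_spec A).1]

theorem isProj_pinv_mul [DecidableEq n] (A : Matrix m n ℂ) : IsProj (pinv A * A) where
  herm := (pinv_spec A).2.2.2
  idem := by rw [← Matrix.mul_assoc, (pinv_spec A).2.1]

/-- Compare two projections `U` and `P` on `A`, where `P` fixes the range of an approximation `N`
of `A Aᴴ`. The Hermitian matrix `K = P U P` mediates: `tr (U N) = tr (K N)`, while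
`tr (K A Aᴴ) ≤ tr (P A Aᴴ)` and `K` has no larger Frobenius norm than `U`. -/
theorem sqNorm_sub_le_of_approx {U : Matrix m m ℂ} (hU : IsProj U) (hP : IsProj P)
    (A : Matrix m n ℂ) {N : Matrix m m ℂ} (hPN : P * N = N) (hNP : N * P = N) :
    sqNorm (A - P * A) ≤
      sqNorm (A - U * A) + 2 * √(U.trace.re) * √(sqNorm (A * Aᴴ - N)) := by
  set E := A * Aᴴ - N with hE
  set K := P * U * P with hK
  have tr_proj : ∀ {Q : Matrix m m ℂ}, IsProj Q → sqNorm (Q * A) = (Q * (A * Aᴴ)).trace.re := by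
    intro Q hQ
    rw [sqNorm_eq_re_trace, Matrix.conjTranspose_mul, hQ.herm, Matrix.mul_assoc, ← Matrix.mul_assoc A,
      Matrix.trace_mul_comm, Matrix.mul_assoc, hQ.idem, Matrix.trace_mul_comm]
  have hUN : (U * N).trace = (K * N).trace := by
    rw [hK, Matrix.mul_assoc, hPN, Matrix.mul_assoc, Matrix.trace_mul_comm P, Matrix.mul_assoc, hNP]
  have hUM : (U * (A * Aᴴ)).trace = (U * E).trace + (U * N).trace := by
    rw [← Matrix.trace_add, ← Matrix.mul_add, hE, sub_add_cancel]
  have hKM : (K * (A * Aᴴ)).trace = (K * E).trace + (K * N).trace := by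
    rw [← Matrix.trace_add, ← Matrix.mul_add, hE, sub_add_cancel]
  have hKle : (K * (A * Aᴴ)).trace.re ≤ sqNorm (P * A) := by
    have : (K * (A * Aᴴ)).trace.re = sqNorm (U * (P * A)) := by
      rw [sqNorm_eq_re_trace, Matrix.conjTranspose_mul, Matrix.conjTranspose_mul, hU.herm, hP.herm]
      calc (K * (A * Aᴴ)).trace.re = (P * (U * U * (P * (A * Aᴴ)))).trace.re := by
            rw [hU.idem, hK]; simp only [Matrix.mul_assoc]
        _ = (U * (U * (P * (A * Aᴴ)) * P)).trace.re := by
            rw [Matrix.trace_mul_comm P]; simp only [Matrix.mul_assoc]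
        _ = _ := by rw [Matrix.trace_mul_comm U]; simp only [Matrix.mul_assoc]
    rw [this]
    exact hU.sqNorm_mul_le _
  have hKnorm : sqNorm K ≤ sqNorm U := by
    calc sqNorm K = sqNorm (P * (U * P)) := by rw [hK, Matrix.mul_assoc]
      _ ≤ sqNorm (U * P) := hP.sqNorm_mul_le _
      _ = sqNorm (P * U) := by
          rw [← sqNorm_conjTranspose, Matrix.conjTranspose_mul, hU.herm, hP.herm]
      _ ≤ sqNorm U := hP.sqNorm_mul_le _
  have h1 := (le_abs_self _).trans (abs_re_trace_mul_le U E)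
  have h2 := (neg_abs_le _).trans' (neg_le_neg (abs_re_trace_mul_le K E))
  have h3 : √(sqNorm K) * √(sqNorm E) ≤ √(sqNorm U) * √(sqNorm E) :=
    mul_le_mul_of_nonneg_right (Real.sqrt_le_sqrt hKnorm) (Real.sqrt_nonneg _)
  have e1 := congrArg Complex.re hUN
  have e2 := congrArg Complex.re hUM
  have e3 := congrArg Complex.re hKM
  rw [Complex.add_re] at e2 e3
  rw [hP.sqNorm_sub, hU.sqNorm_sub, tr_proj hU, ← hU.sqNorm_eq]
  linarith

end SqNorm

theorem sum_fin_ite_le_sum_Ico {N a r : ℕ} (f : ℕ → ℝ) (hf : ∀ i, 0 ≤ f i)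
    (ha : ∀ i, a ≤ i → f i = 0) :
    ∑ i : Fin N, (if (i : ℕ) < r then 0 else f i) ≤ ∑ k ∈ Finset.Ico r a, f k := by
  rw [Fin.sum_univ_eq_sum_range (fun i => if i < r then 0 else f i)]
  set g : ℕ → ℝ := fun i => if i < r then 0 else f i with hg
  have hg0 : ∀ i, 0 ≤ g i := fun i => by rw [hg]; dsimp only; split_ifs <;> simp [hf]
  calc ∑ i ∈ Finset.range N, g i ≤ ∑ i ∈ Finset.range N ∪ Finset.Ico r a, g i :=
        Finset.sum_le_sum_of_subset_of_nonneg Finset.subset_union_left fun i _ _ => hg0 i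
    _ = ∑ i ∈ Finset.Ico r a, g i := by
        refine (Finset.sum_subset Finset.subset_union_right fun i _ hi => ?_).symm
        rw [Finset.mem_Ico, not_and_or, not_le, not_lt] at hi
        rcases hi with hi | hi
        · exact if_pos hi
        · rw [hg]; dsimp only; rw [ha i hi, ite_self]
    _ = _ := Finset.sum_congr rfl fun i hi => if_neg (not_lt.2 (Finset.mem_Ico.1 hi).1)

/-- Truncating the singular value decomposition: some projection of rank at most `r` leaves a
residual of at most `∑_{k > r} σ_k(A)²`. -/
theorem exists_isProj_sqNorm_sub_le_tailSq {a : ℕ} {κ : Type*} [Fintype κ] [DecidableEq κ]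
    (A : Matrix (Fin a) κ ℂ) (r : ℕ) :
    ∃ U : Matrix (Fin a) (Fin a) ℂ, IsProj U ∧ U.trace.re ≤ r ∧
      sqNorm (A - U * A) ≤ tailSq A r := by
  classical
  set T := Matrix.toEuclideanLin A with hT
  have hN : Module.finrank ℂ (EuclideanSpace ℂ κ) = Fintype.card κ := finrank_euclideanSpace
  set b := T.isSymmetric_adjoint_comp_self.eigenvectorBasis hN with hb
  -- The columns of `V` are the right singular vectors, those of `A * V` their images under `A`.
  set V : Matrix κ (Fin (Fintype.card κ)) ℂ := Matrix.of fun k i => b i k with hV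
  have hVV : V * Vᴴ = 1 := by
    have hsq : Vᴴ * V = 1 := by
      ext i j
      have := orthonormal_iff_ite.1 b.orthonormal i j
      rw [EuclideanSpace.inner_eq_star_dotProduct] at this
      rw [Matrix.one_apply, ← this, Matrix.mul_apply, dotProduct]
      exact Finset.sum_congr rfl fun k _ => mul_comm _ _
    exact (Matrix.mul_eq_one_comm_of_equiv (Fintype.equivFin κ)).2 hsq
  have hcol : ∀ i j, (A * V) j i = T (b i) j := by
    intro i j
    rw [hT, Matrix.mul_apply]
    rfl
  have hσ : ∀ i : Fin (Fintype.card κ), ∑ j, ‖(A * V) j i‖ ^ 2 = T.singularValues i ^ 2 := by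
    intro i
    rw [T.sq_singularValues_fin hN]
    simp only [hcol]
    rw [← EuclideanSpace.norm_sq_eq]
    have h1 := T.isSymmetric_adjoint_comp_self.apply_eigenvectorBasis hN i
    have h2 : inner ℂ (T (b i)) (T (b i)) =
        ((T.isSymmetric_adjoint_comp_self.eigenvalues hN i : ℝ) : ℂ) := by
      rw [← LinearMap.adjoint_inner_right, ← LinearMap.comp_apply, hb, h1, inner_smul_right,
        inner_self_eq_norm_sq_to_K, OrthonormalBasis.norm_eq_one]
      simp
    rw [inner_self_eq_norm_sq_to_K] at h2
    have h3 := congrArg Complex.re h2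
    rw [Complex.ofReal_re] at h3
    rw [← h3, ← RCLike.ofReal_pow]
    exact (RCLike.ofReal_re (K := ℂ) (‖T (b i)‖ ^ 2)).symm
  set D : Matrix (Fin (Fintype.card κ)) (Fin (Fintype.card κ)) ℂ :=
    Matrix.diagonal fun i => if (i : ℕ) < r then 1 else 0 with hD
  -- `U` projects onto the span of the first `r` left singular vectors.
  set B := A * V * D with hB
  refine ⟨B * pinv B, isProj_mul_pinv B, ?_, ?_⟩
  · -- `tr (B B†) = tr (B† B)`, and the projection `B† B` has at most `r` nonzero diagonal entries.
    rw [Matrix.trace_mul_comm]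
    have hQ := isProj_pinv_mul B
    have hBD : B * D = B := by
      rw [hB, Matrix.mul_assoc, hD, Matrix.diagonal_mul_diagonal]
      congr 2
      ext i
      split_ifs <;> simp
    have hQD : pinv B * B * D = pinv B * B := by rw [Matrix.mul_assoc, hBD]
    have hdiag : ∀ i, ((pinv B * B) i i).re ≤ if (i : ℕ) < r then 1 else 0 := by
      intro i
      split_ifs with h
      · exact hQ.re_apply_self_le_one i
      · rw [← hQD, hD, Matrix.mul_diagonal, if_neg h, mul_zero, Complex.zero_re]
    rw [Matrix.trace, Complex.re_sum]
    refine (Finset.sum_le_sum fun i _ => hdiag i).trans ?_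
    have := sum_fin_ite_le_sum_Ico (N := Fintype.card κ) (a := r) (r := 0)
      (fun i => if i < r then (1 : ℝ) else 0) (fun i => by split_ifs <;> simp)
      (fun i hi => if_neg (not_lt.2 hi))
    simp only [Nat.not_lt_zero, if_false] at this
    refine this.trans ?_
    rw [← Finset.sum_filter, Finset.sum_const, nsmul_eq_mul, mul_one]
    exact_mod_cast (Finset.card_filter_le _ _).trans (by simp)
  · have h1 : sqNorm (A - B * pinv B * A) ≤ sqNorm (A - B * Vᴴ) :=
      (isProj_mul_pinv B).sqNorm_sub_mul_le_of_mul_eq A (by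
        rw [← Matrix.mul_assoc, (pinv_spec B).1])
    refine h1.trans ?_
    have h2 : sqNorm (A - B * Vᴴ) = ∑ i : Fin (Fintype.card κ),
        if (i : ℕ) < r then 0 else T.singularValues i ^ 2 := by
      have hVV' : Vᴴ * V = 1 := (Matrix.mul_eq_one_comm_of_equiv (Fintype.equivFin κ)).1 hVV
      rw [← sqNorm_mul_unitary _ V hVV, Matrix.sub_mul, Matrix.mul_assoc B, hVV', Matrix.mul_one,
        sqNorm, Finset.sum_comm]
      refine Finset.sum_congr rfl fun i _ => ?_
      rw [← hσ i]
      split_ifs with h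
      · simp [hB, hD, Matrix.mul_diagonal, h]
      · simp [hB, hD, Matrix.mul_diagonal, h]
    rw [h2]
    refine sum_fin_ite_le_sum_Ico (fun i => T.singularValues i ^ 2) (fun i => by positivity) ?_
    intro i hi
    have : Module.finrank ℂ T.range ≤ i := by
      refine le_trans (Submodule.finrank_le _) ?_
      simpa using hi
    simp [T.singularValues_eq_zero_iff_le_finrank_range.2 this]

/-! ### Concentration for independent draws from a finite distribution -/

section ProductExpectation

variable {κ : Type*} [Fintype κ] {p : κ → ℝ}

/-- The expectation of `f (s 0, …, s (n - 1))` for independent `s t` with distribution `p`. -/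
noncomputable def expect (p : κ → ℝ) {n : ℕ} (f : (Fin n → κ) → ℝ) : ℝ :=
  ∑ s : Fin n → κ, (∏ t, p (s t)) * f s

theorem expect_zero (f : (Fin 0 → κ) → ℝ) : expect p f = f Fin.elim0 := by
  rw [expect, Fintype.sum_unique, Fin.prod_univ_zero, one_mul, Subsingleton.elim default Fin.elim0]

theorem expect_succ {n : ℕ} (f : (Fin (n + 1) → κ) → ℝ) :
    expect p f = ∑ k, p k * expect p fun s => f (Fin.cons k s) := by
  rw [expect, ← (Fin.consEquiv fun _ => κ).sum_comp, Fintype.sum_prod_type]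
  refine Finset.sum_congr rfl fun k _ => ?_
  rw [expect, Finset.mul_sum]
  refine Finset.sum_congr rfl fun s _ => ?_
  change (∏ t, p ((Fin.cons k s : Fin (n + 1) → κ) t)) * f (Fin.cons k s) = _
  rw [Fin.prod_univ_succ, Fin.cons_zero, mul_assoc]
  simp only [Fin.cons_succ]

theorem expect_mono (hp : ∀ k, 0 ≤ p k) {n : ℕ} {f g : (Fin n → κ) → ℝ} (h : ∀ s, f s ≤ g s) :
    expect p f ≤ expect p g :=
  Finset.sum_le_sum fun s _ => mul_le_mul_of_nonneg_left (h s) (Finset.prod_nonneg fun _ _ => hp _)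

theorem expect_const_mul {n : ℕ} (a : ℝ) (f : (Fin n → κ) → ℝ) :
    expect p (fun s => a * f s) = a * expect p f := by
  rw [expect, expect, Finset.mul_sum]
  exact Finset.sum_congr rfl fun s _ => by ring

theorem expect_add {n : ℕ} (f g : (Fin n → κ) → ℝ) :
    expect p (fun s => f s + g s) = expect p f + expect p g := by
  simp only [expect, mul_add, Finset.sum_add_distrib]

theorem sum_prod_eq_one (hp1 : ∑ k, p k = 1) (n : ℕ) :
    ∑ s : Fin n → κ, ∏ t, p (s t) = 1 := by
  have := Finset.prod_univ_sum (fun _ : Fin n => (Finset.univ : Finset κ)) fun _ k => p k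
  rw [Fintype.piFinset_univ] at this
  rw [← this, hp1, Finset.prod_const_one]

theorem expect_const (hp1 : ∑ k, p k = 1) {n : ℕ} (a : ℝ) :
    expect p (fun _ : Fin n → κ => a) = a := by
  rw [expect, ← Finset.sum_mul, sum_prod_eq_one hp1, one_mul]

theorem sq_expect_le (hp : ∀ k, 0 ≤ p k) (hp1 : ∑ k, p k = 1) {n : ℕ} (f : (Fin n → κ) → ℝ) :
    expect p f ^ 2 ≤ expect p fun s => f s ^ 2 := by
  have h : ∀ s, 2 * expect p f * f s + -(expect p f ^ 2) ≤ f s ^ 2 := fun s => by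
    nlinarith [sq_nonneg (f s - expect p f)]
  have := expect_mono hp h
  rw [expect_add, expect_const_mul, expect_const hp1] at this
  nlinarith

/-- Hoeffding's lemma for a finite distribution, in the form needed for a bounded martingale
difference. -/
theorem sum_mul_exp_le (hp : ∀ k, 0 ≤ p k) (hp1 : ∑ k, p k = 1) {L : ℝ} (hL : 0 < L) (x : ℝ)
    {g : κ → ℝ} (hg : ∀ k k', g k - g k' ≤ L) :
    ∑ k, p k * Real.exp (x * g k) ≤ Real.exp (x * ∑ k, p k * g k + x ^ 2 * L ^ 2 / 2) := by
  set m := ∑ k, p k * g k with hm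
  have hdev : ∀ k, |g k - m| ≤ L := by
    intro k
    have h1 : g k - m = ∑ k', p k' * (g k - g k') := by
      simp only [mul_sub, Finset.sum_sub_distrib, ← Finset.sum_mul, hp1, one_mul, hm]
    rw [h1]
    refine (Finset.abs_sum_le_sum_abs _ _).trans ?_
    calc ∑ k', |p k' * (g k - g k')| ≤ ∑ k', p k' * L := Finset.sum_le_sum fun k' _ => by
          rw [abs_mul, abs_of_nonneg (hp k')]
          exact mul_le_mul_of_nonneg_left (abs_le.2 ⟨by linarith [hg k' k], hg k k'⟩) (hp k')
      _ = L := by rw [← Finset.sum_mul, hp1, one_mul]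
  -- The chord of `exp (x ·)` over `[-L, L]` dominates it there, and is affine, so it integrates.
  have hchord : ∀ k, Real.exp (x * (g k - m)) ≤
      Real.cosh (x * L) + (g k - m) * (Real.sinh (x * L) / L) := by
    intro k
    obtain ⟨h1, h2⟩ := abs_le.1 (hdev k)
    have hge : 0 ≤ (1 + (g k - m) / L) / 2 := by
      have : -1 ≤ (g k - m) / L := by rw [le_div_iff₀ hL]; linarith
      linarith
    have hle : 0 ≤ (1 - (g k - m) / L) / 2 := by
      have : (g k - m) / L ≤ 1 := by rw [div_le_iff₀ hL]; linarith
      linarith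
    have hconv := convexOn_exp.2 (Set.mem_univ (x * L)) (Set.mem_univ (-(x * L))) hge hle (by ring)
    simp only [smul_eq_mul] at hconv
    have e1 : (1 + (g k - m) / L) / 2 * (x * L) + (1 - (g k - m) / L) / 2 * -(x * L) =
        x * (g k - m) := by field_simp; ring
    rw [e1] at hconv
    refine hconv.trans (le_of_eq ?_)
    rw [Real.cosh_eq, Real.sinh_eq]
    field_simp
    ring
  have h0 : ∑ k, p k * (g k - m) = 0 := by
    simp only [mul_sub, Finset.sum_sub_distrib, ← Finset.sum_mul, hp1, one_mul, hm, sub_self]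
  calc ∑ k, p k * Real.exp (x * g k)
      = Real.exp (x * m) * ∑ k, p k * Real.exp (x * (g k - m)) := by
        rw [Finset.mul_sum]
        refine Finset.sum_congr rfl fun k _ => ?_
        rw [mul_left_comm, ← Real.exp_add]
        congr 2
        ring
    _ ≤ Real.exp (x * m) * ∑ k, p k *
          (Real.cosh (x * L) + (g k - m) * (Real.sinh (x * L) / L)) := by
        refine mul_le_mul_of_nonneg_left ?_ (Real.exp_pos _).le
        exact Finset.sum_le_sum fun k _ => mul_le_mul_of_nonneg_left (hchord k) (hp k)
    _ = Real.exp (x * m) * Real.cosh (x * L) := by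
        simp only [mul_add, Finset.sum_add_distrib, ← mul_assoc, ← Finset.sum_mul, hp1, h0]
        ring
    _ ≤ Real.exp (x * m) * Real.exp (x ^ 2 * L ^ 2 / 2) := by
        refine mul_le_mul_of_nonneg_left ((Real.cosh_le_exp_half_sq _).trans (le_of_eq ?_))
          (Real.exp_pos _).le
        rw [mul_pow]
    _ = _ := by rw [← Real.exp_add]

/-- Exponential moments of a function of independent variables with bounded differences, by
conditioning on the first variable. -/
theorem expect_exp_le (hp : ∀ k, 0 ≤ p k) (hp1 : ∑ k, p k = 1) {L : ℝ} (hL : 0 < L) (x : ℝ) :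
    ∀ {n : ℕ} (f : (Fin n → κ) → ℝ),
      (∀ s t k, f s - f (Function.update s t k) ≤ L) →
      expect p (fun s => Real.exp (x * f s)) ≤
        Real.exp (x * expect p f + n * (x ^ 2 * L ^ 2 / 2)) := by
  intro n
  induction n with
  | zero =>
    intro f _
    simp [expect_zero]
  | succ n ih =>
    intro f hf
    rw [expect_succ, expect_succ (f := f)]
    have hcons : ∀ k, expect p (fun s => Real.exp (x * f (Fin.cons k s))) ≤
        Real.exp (x * expect p fun s => f (Fin.cons k s)) *
          Real.exp (n * (x ^ 2 * L ^ 2 / 2)) := by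
      intro k
      rw [← Real.exp_add]
      refine ih (fun s => f (Fin.cons k s)) fun s t k' => ?_
      rw [Fin.cons_update]
      exact hf _ _ _
    have hdiff : ∀ k k', (expect p fun s : Fin n → κ => f (Fin.cons k s)) -
        (expect p fun s : Fin n → κ => f (Fin.cons k' s)) ≤ L := by
      intro k k'
      have h : ∀ s : Fin n → κ, f (Fin.cons k s) ≤ f (Fin.cons k' s) + L := by
        intro s
        have := hf (Fin.cons k s) 0 k'
        rw [Fin.update_cons_zero] at this
        linarith
      have := expect_mono hp h
      rw [expect_add, expect_const hp1] at this
      linarith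
    calc ∑ k, p k * expect p (fun s => Real.exp (x * f (Fin.cons k s)))
        ≤ ∑ k, p k * Real.exp (x * expect p fun s => f (Fin.cons k s)) *
            Real.exp (n * (x ^ 2 * L ^ 2 / 2)) := Finset.sum_le_sum fun k _ => by
          rw [mul_assoc]
          exact mul_le_mul_of_nonneg_left (hcons k) (hp k)
      _ ≤ Real.exp (x * ∑ k, p k * (expect p fun s => f (Fin.cons k s)) + x ^ 2 * L ^ 2 / 2) *
            Real.exp (n * (x ^ 2 * L ^ 2 / 2)) := by
          rw [← Finset.sum_mul]
          exact mul_le_mul_of_nonneg_right (sum_mul_exp_le hp hp1 hL x hdiff) (Real.exp_pos _).le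
      _ = _ := by
          rw [← Real.exp_add]
          push_cast
          ring_nf

/-- McDiarmid's inequality for a finite distribution. -/
theorem expect_indicator_le_exp (hp : ∀ k, 0 ≤ p k) (hp1 : ∑ k, p k = 1) {L : ℝ} (hL : 0 < L)
    {n : ℕ} (hn : 0 < n) (f : (Fin n → κ) → ℝ)
    (hf : ∀ s t k, f s - f (Function.update s t k) ≤ L) {τ : ℝ} (hτ : 0 ≤ τ) :
    expect p ({s | expect p f + τ < f s}.indicator 1) ≤ Real.exp (-(τ ^ 2 / (2 * n * L ^ 2))) := by
  have hn' : (0 : ℝ) < n := by exact_mod_cast hn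
  -- The Chernoff exponent is optimal at this `x`.
  set x := τ / (n * L ^ 2) with hx
  have hx0 : 0 ≤ x := by positivity
  have h : ∀ s, ({s | expect p f + τ < f s}.indicator 1 s : ℝ) ≤
      Real.exp (-(x * (expect p f + τ))) * Real.exp (x * f s) := by
    intro s
    rw [← Real.exp_add]
    by_cases hs : expect p f + τ < f s
    · rw [Set.indicator_of_mem (by exact hs), Pi.one_apply, Real.one_le_exp_iff]
      nlinarith
    · rw [Set.indicator_of_notMem (by exact hs)]
      exact (Real.exp_pos _).le
  refine (expect_mono hp h).trans ?_
  rw [expect_const_mul]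
  refine (mul_le_mul_of_nonneg_left (expect_exp_le hp hp1 hL x f hf) (Real.exp_pos _).le).trans ?_
  rw [← Real.exp_add, Real.exp_le_exp]
  apply le_of_eq
  rw [hx]
  field_simp
  ring

section InnerProductSpace

variable {𝕜 H : Type*} [RCLike 𝕜] [NormedAddCommGroup H] [InnerProductSpace 𝕜 H]

/-- Variances of independent centred vectors add up. -/
theorem expect_norm_sum_sq (hp1 : ∑ k, p k = 1) (y : κ → H) (hy : ∑ k, (p k : 𝕜) • y k = 0)
    (n : ℕ) : expect p (fun s : Fin n → κ => ‖∑ t, y (s t)‖ ^ 2) = n * ∑ k, p k * ‖y k‖ ^ 2 := by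
  induction n with
  | zero => simp [expect_zero]
  | succ n ih =>
    rw [expect_succ]
    have h : ∀ k, expect p (fun s : Fin n → κ => ‖∑ t, y ((Fin.cons k s : Fin (n + 1) → κ) t)‖ ^ 2) =
        ‖y k‖ ^ 2 + (expect p (fun s : Fin n → κ => 2 * RCLike.re (inner 𝕜 (y k) (∑ t, y (s t)))) +
          n * ∑ k, p k * ‖y k‖ ^ 2) := by
      intro k
      rw [← ih, ← expect_add]
      conv_rhs => rw [← expect_const hp1 (n := n) (‖y k‖ ^ 2), ← expect_add]
      congr 1
      funext s
      rw [Fin.sum_univ_succ]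
      simp only [Fin.cons_zero, Fin.cons_succ]
      rw [norm_add_sq (𝕜 := 𝕜)]
      ring
    simp only [h, mul_add, Finset.sum_add_distrib, ← Finset.sum_mul, hp1]
    have hcross : ∑ k, p k * expect p
        (fun s : Fin n → κ => 2 * RCLike.re (inner 𝕜 (y k) (∑ t, y (s t)))) = 0 := by
      simp only [expect, Finset.mul_sum]
      rw [Finset.sum_comm]
      refine Finset.sum_eq_zero fun s _ => ?_
      have hz : ∑ k, p k * RCLike.re (inner 𝕜 (y k) (∑ t, y (s t))) = 0 := by
        have := congrArg (fun v => RCLike.re (inner 𝕜 v (∑ t, y (s t)))) hy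
        simp only [sum_inner, inner_smul_left, RCLike.conj_ofReal, map_sum, RCLike.re_ofReal_mul,
          inner_zero_left, map_zero] at this
        exact this
      calc _ = (∏ t, p (s t)) * 2 *
            ∑ k, p k * RCLike.re (inner 𝕜 (y k) (∑ t, y (s t))) := by
            rw [Finset.mul_sum]
            exact Finset.sum_congr rfl fun k _ => by ring
        _ = 0 := by rw [hz, mul_zero]
    rw [hcross]
    push_cast
    ring

theorem sum_mul_norm_sub_mean_sq_le (hp1 : ∑ k, p k = 1) (z : κ → H) {m : H}
    (hm : ∑ k, (p k : 𝕜) • z k = m) :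
    ∑ k, p k * ‖z k - m‖ ^ 2 ≤ ∑ k, p k * ‖z k‖ ^ 2 := by
  have hz : ∑ k, p k * RCLike.re (inner 𝕜 (z k) m) = ‖m‖ ^ 2 := by
    have := congrArg (fun v => RCLike.re (inner 𝕜 v m)) hm
    simp only [sum_inner, inner_smul_left, RCLike.conj_ofReal, map_sum, RCLike.re_ofReal_mul,
      inner_self_eq_norm_sq] at this
    exact this
  have h : ∀ k, p k * ‖z k - m‖ ^ 2 =
      p k * ‖z k‖ ^ 2 - 2 * (p k * RCLike.re (inner 𝕜 (z k) m)) + p k * ‖m‖ ^ 2 := by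
    intro k
    rw [norm_sub_sq (𝕜 := 𝕜)]
    ring
  simp only [h, Finset.sum_add_distrib, Finset.sum_sub_distrib, ← Finset.mul_sum, hz,
    ← Finset.sum_mul, hp1]
  nlinarith [sq_nonneg ‖m‖]

theorem expect_norm_sum_sub_mean_le (hp : ∀ k, 0 ≤ p k) (hp1 : ∑ k, p k = 1) (z : κ → H) {m : H}
    (hm : ∑ k, (p k : 𝕜) • z k = m) (n : ℕ) :
    expect p (fun s : Fin n → κ => ‖∑ t, (z (s t) - m)‖) ≤ √(n * ∑ k, p k * ‖z k‖ ^ 2) := by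
  apply Real.le_sqrt_of_sq_le
  refine (sq_expect_le hp hp1 _).trans ?_
  rw [expect_norm_sum_sq (𝕜 := 𝕜) hp1 fun k => z k - m]
  · exact mul_le_mul_of_nonneg_left (sum_mul_norm_sub_mean_sq_le hp1 z hm) (Nat.cast_nonneg n)
  · simp only [smul_sub, Finset.sum_sub_distrib, hm, ← Finset.sum_smul]
    rw [← RCLike.ofReal_sum, hp1, RCLike.ofReal_one, one_smul, sub_self]

/-- Concentration of the empirical mean of `n` independent vectors of norm at most `b / β` and mean
norm at most `b`. The mean deviation is at most `b / √(β n)`, by the variance bound, and changing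
one of the vectors changes the sum by at most `2 b / β`. -/
theorem expect_indicator_norm_sum_le (hp : ∀ k, 0 ≤ p k) (hp1 : ∑ k, p k = 1) (z : κ → H) {m : H}
    (hm : ∑ k, (p k : 𝕜) • z k = m) {β b δ : ℝ} (hβ : 0 < β) (hb : 0 < b) (hδ₀ : 0 < δ)
    (hδ₁ : δ < 1) (hz : ∀ k, ‖z k‖ ≤ b / β) (hzm : ∑ k, p k * ‖z k‖ ≤ b) {n : ℕ} (hn : 0 < n) :
    expect p ({s : Fin n → κ | (1 + √(8 / β * Real.log (1 / δ))) * (b * √(n / β)) <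
      ‖∑ t, (z (s t) - m)‖}.indicator 1) ≤ δ := by
  have hn' : (0 : ℝ) < n := by exact_mod_cast hn
  set f : (Fin n → κ) → ℝ := fun s => ‖∑ t, (z (s t) - m)‖ with hf
  have hmean : expect p f ≤ b * √(n / β) := by
    refine (expect_norm_sum_sub_mean_le (𝕜 := 𝕜) hp hp1 z hm n).trans ?_
    have h1 : ∑ k, p k * ‖z k‖ ^ 2 ≤ b * (b / β) := by
      calc ∑ k, p k * ‖z k‖ ^ 2 ≤ ∑ k, p k * ‖z k‖ * (b / β) := Finset.sum_le_sum fun k _ => by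
            rw [sq, ← mul_assoc]
            exact mul_le_mul_of_nonneg_left (hz k) (mul_nonneg (hp k) (norm_nonneg _))
        _ ≤ b * (b / β) := by
            rw [← Finset.sum_mul]
            exact mul_le_mul_of_nonneg_right hzm (by positivity)
    calc √(n * ∑ k, p k * ‖z k‖ ^ 2) ≤ √(b ^ 2 * (n / β)) :=
          Real.sqrt_le_sqrt ((mul_le_mul_of_nonneg_left h1 hn'.le).trans (le_of_eq (by ring)))
      _ = b * √(n / β) := by rw [Real.sqrt_mul (sq_nonneg b), Real.sqrt_sq hb.le]
  have hdiff : ∀ s t k, f s - f (Function.update s t k) ≤ 2 * (b / β) := by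
    intro s t k
    refine (norm_sub_norm_le _ _).trans ?_
    have h1 : ∑ u, (z (s u) - m) - ∑ u, (z (Function.update s t k u) - m) = z (s t) - z k := by
      rw [← Finset.sum_sub_distrib, Finset.sum_eq_single t]
      · simp
      · intro u _ hu
        rw [Function.update_of_ne hu, sub_self]
      · simp
    rw [h1]
    refine (norm_sub_le _ _).trans ?_
    linarith [hz (s t), hz k]
  set τ := √(8 / β * Real.log (1 / δ)) * (b * √(n / β)) with hτ
  have hlog : 0 < Real.log (1 / δ) := Real.log_pos (by rw [lt_div_iff₀ hδ₀]; linarith)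
  have hmain := expect_indicator_le_exp hp hp1 (L := 2 * (b / β)) (by positivity) hn f hdiff
    (τ := τ) (by positivity)
  have hexp : Real.exp (-(τ ^ 2 / (2 * n * (2 * (b / β)) ^ 2))) = δ := by
    have : τ ^ 2 / (2 * n * (2 * (b / β)) ^ 2) = Real.log (1 / δ) := by
      rw [hτ, mul_pow, mul_pow, Real.sq_sqrt (by positivity), Real.sq_sqrt (by positivity)]
      field_simp
      norm_num
    rw [this, one_div, Real.log_inv, neg_neg, Real.exp_log hδ₀]
  rw [hexp] at hmain
  refine (expect_mono hp fun s => ?_).trans hmain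
  refine Set.indicator_le_indicator_of_subset (fun s hs => ?_) (fun _ => zero_le_one) s
  rw [Set.mem_ofPred_eq] at hs ⊢
  refine lt_of_le_of_lt ?_ hs
  rw [hτ, add_mul, one_mul]
  linarith

end InnerProductSpace

end ProductExpectation

/-! ### Comparison of draws with and without replacement -/

open MeasureTheory

section Sampling

variable {κ : Type*} [Fintype κ] [DecidableEq κ] {p : κ → ℝ}

/-- The expectation of `b` at the set obtained from `T` by adding the outcomes of `m` independent
draws with distribution `p`. -/
noncomputable def drawMean (p : κ → ℝ) (b : Finset κ → ℝ) : ℕ → Finset κ → ℝ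
  | 0, T => b T
  | m + 1, T => ∑ k, p k * drawMean p b m (insert k T)

theorem drawMean_eq_expect (b : Finset κ → ℝ) (m : ℕ) (T : Finset κ) :
    drawMean p b m T = expect p fun s : Fin m → κ => b (T ∪ Finset.univ.image s) := by
  induction m generalizing T with
  | zero => simp [drawMean, expect_zero]
  | succ m ih =>
    rw [drawMean, expect_succ]
    refine Finset.sum_congr rfl fun k _ => ?_
    rw [ih]
    congr 2
    funext s
    congr 1
    ext x
    simp only [Finset.mem_union, Finset.mem_insert, Finset.mem_image, Finset.mem_univ, true_and,
      Fin.exists_fin_succ, Fin.cons_zero, Fin.cons_succ]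
    tauto

theorem drawMean_antitone (hp : ∀ k, 0 ≤ p k) {b : Finset κ → ℝ} (hb : Antitone b) (m : ℕ) :
    Antitone (drawMean p b m) := by
  induction m with
  | zero => exact hb
  | succ m ih =>
    intro T T' h
    exact Finset.sum_le_sum fun k _ =>
      mul_le_mul_of_nonneg_left (ih (Finset.insert_subset_insert k h)) (hp k)

theorem drawMean_succ_le (hp : ∀ k, 0 ≤ p k) (hp1 : ∑ k, p k = 1) {b : Finset κ → ℝ}
    (hb : Antitone b) (m : ℕ) (T : Finset κ) : drawMean p b (m + 1) T ≤ drawMean p b m T := by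
  calc drawMean p b (m + 1) T ≤ ∑ k, p k * drawMean p b m T := Finset.sum_le_sum fun k _ =>
        mul_le_mul_of_nonneg_left (drawMean_antitone hp hb m (Finset.subset_insert k T)) (hp k)
    _ = _ := by rw [← Finset.sum_mul, hp1, one_mul]

/-- One draw without replacement is at least as good as one independent draw: the latter wastes the
draws that fall into `T`. Here `w k` is the probability of reaching `T` and then drawing `k`. -/
theorem sum_mul_drawMean_insert_le (hp : ∀ k, 0 ≤ p k) (hp1 : ∑ k, p k = 1) {b : Finset κ → ℝ}
    (hb : Antitone b) (m : ℕ) (T : Finset κ) {w : κ → ℝ} {W : ℝ} (hw : ∀ k, 0 ≤ w k)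
    (hW : ∑ k, w k = W) (hT : ∀ k ∈ T, w k = 0)
    (hlaw : ∀ k ∉ T, w k * (1 - ∑ u ∈ T, p u) = W * p k) :
    ∑ k, w k * drawMean p b m (insert k T) ≤ W * drawMean p b (m + 1) T := by
  have hsplit : ∑ k ∈ T, p k + ∑ k ∈ Tᶜ, p k = 1 := by rw [Finset.sum_add_sum_compl, hp1]
  have hV : drawMean p b (m + 1) T =
      (∑ k ∈ T, p k) * drawMean p b m T + ∑ k ∈ Tᶜ, p k * drawMean p b m (insert k T) := by
    rw [drawMean, ← Finset.sum_add_sum_compl T, Finset.sum_mul]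
    congr 1
    exact Finset.sum_congr rfl fun k hk => by rw [Finset.insert_eq_of_mem hk]
  have hW0 : 0 ≤ W := hW ▸ Finset.sum_nonneg fun k _ => hw k
  have hq0 : 0 ≤ ∑ k ∈ Tᶜ, p k := Finset.sum_nonneg fun k _ => hp k
  rcases hq0.eq_or_lt with hq | hq
  · -- All the mass has been drawn: the further draws are arbitrary, but independent ones are void.
    have hz : ∀ k ∈ Tᶜ, p k = 0 := (Finset.sum_eq_zero_iff_of_nonneg fun k _ => hp k).1 hq.symm
    have h1 : ∑ k ∈ Tᶜ, p k * drawMean p b m (insert k T) = 0 :=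
      Finset.sum_eq_zero fun k hk => by rw [hz k hk, zero_mul]
    have h2 : ∑ k ∈ T, p k = 1 := by linarith
    rw [hV, h1, h2, one_mul, add_zero, ← hW, Finset.sum_mul]
    exact Finset.sum_le_sum fun k _ =>
      mul_le_mul_of_nonneg_left (drawMean_antitone hp hb m (Finset.subset_insert k T)) (hw k)
  · refine le_of_mul_le_mul_right ?_ hq
    have h1 : (∑ k, w k * drawMean p b m (insert k T)) * ∑ k ∈ Tᶜ, p k =
        W * ∑ k ∈ Tᶜ, p k * drawMean p b m (insert k T) := by
      rw [← Finset.sum_add_sum_compl T, Finset.sum_eq_zero (s := T) fun k hk => by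
        rw [hT k hk, zero_mul], zero_add, Finset.sum_mul, Finset.mul_sum]
      refine Finset.sum_congr rfl fun k hk => ?_
      have := hlaw k (Finset.mem_compl.1 hk)
      rw [show 1 - ∑ u ∈ T, p u = ∑ k ∈ Tᶜ, p k by linarith] at this
      rw [mul_right_comm, this, mul_assoc]
    rw [h1, mul_assoc]
    refine mul_le_mul_of_nonneg_left ?_ hW0
    have h2 := mul_le_mul_of_nonneg_left (drawMean_succ_le hp hp1 hb m T)
      (Finset.sum_nonneg fun k (_ : k ∈ T) => hp k)
    have h3 : (∑ k ∈ Tᶜ, p k * drawMean p b m (insert k T)) =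
      drawMean p b (m + 1) T - (∑ k ∈ T, p k) * drawMean p b m T := by linarith
    have h4 : ∑ k ∈ Tᶜ, p k = 1 - ∑ k ∈ T, p k := by linarith
    rw [h3, h4]
    linarith

end Sampling

section Law

variable {κ : Type*} {p : κ → ℝ} {Ω : Type*} [MeasurableSpace Ω] {μ : Measure Ω} {c : ℕ}
  {S : Fin c → Ω → κ}

/-- The probability that the first `t` draws are given by `σ`. -/
noncomputable def prefixProb (μ : Measure Ω) (S : Fin c → Ω → κ) (t : ℕ) (σ : Fin t → κ) : ℝ :=
  μ.real {ω | ∀ (u : Fin c) (h : (u : ℕ) < t), S u ω = σ ⟨u, h⟩}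

theorem SampledWithoutReplacement.prefixProb_eq_zero (h : SampledWithoutReplacement μ p S) {t : ℕ}
    (ht : t ≤ c) {σ : Fin t → κ} (hσ : ¬ Function.Injective σ) : prefixProb μ S t σ = 0 := by
  have h0 : μ {ω | ¬ Function.Injective fun t => S t ω} = 0 := ae_iff.1 h.distinct
  rw [prefixProb, Measure.real, measure_mono_null (t := {ω | ¬ Function.Injective fun t => S t ω})
    (fun ω hω hinj => hσ fun u v huv => ?_) h0, ENNReal.toReal_zero]
  have hu := hω (Fin.castLE ht u) u.2
  have hv := hω (Fin.castLE ht v) v.2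
  have := hinj (hu.trans (huv.trans hv.symm))
  exact Fin.castLE_injective ht this

theorem SampledWithoutReplacement.prefixProb_snoc (h : SampledWithoutReplacement μ p S) {t : ℕ}
    (ht : t < c) (σ : Fin t → κ) {k : κ} (hk : ∀ u, σ u ≠ k) :
    prefixProb μ S (t + 1) (Fin.snoc σ k : Fin (t + 1) → κ) * (1 - ∑ u, p (σ u)) =
      prefixProb μ S t σ * p k := by
  set s : Fin c → κ := fun u => if hu : (u : ℕ) < t then σ ⟨u, hu⟩ else k with hs
  have hst : s ⟨t, ht⟩ = k := dif_neg (lt_irrefl t)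
  have hslt : ∀ (u : Fin c) (hu : (u : ℕ) < t), s u = σ ⟨u, hu⟩ := fun u hu => dif_pos hu
  have hlaw := h.law ⟨t, ht⟩ s fun u hu => by rw [hst, hslt u hu]; exact hk _
  have hsum : ∑ u ∈ Finset.univ.filter (· < (⟨t, ht⟩ : Fin c)), p (s u) = ∑ u, p (σ u) := by
    symm
    refine Finset.sum_bij (fun u _ => Fin.castLE ht.le u) (fun u _ => ?_) (fun u _ v _ huv => ?_)
      (fun u hu => ?_) fun u _ => ?_
    · simp [Fin.lt_def]
    · exact Fin.castLE_injective ht.le huv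
    · have hu' : (u : ℕ) < t := (Finset.mem_filter.1 hu).2
      exact ⟨⟨u, hu'⟩, Finset.mem_univ _, rfl⟩
    · rw [hslt _ u.2]
      rfl
  rw [hsum, hst] at hlaw
  have e1 : {ω | ∀ u ≤ (⟨t, ht⟩ : Fin c), S u ω = s u} =
      {ω | ∀ (u : Fin c) (h : (u : ℕ) < t + 1),
        S u ω = (Fin.snoc σ k : Fin (t + 1) → κ) ⟨u, h⟩} := by
    have hsnoc : ∀ (u : Fin c) (hu : (u : ℕ) < t + 1),
        (Fin.snoc σ k : Fin (t + 1) → κ) ⟨u, hu⟩ = s u := by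
      intro u hu
      rcases Nat.lt_succ_iff_lt_or_eq.1 hu with hlt | heq
      · rw [show (⟨u, hu⟩ : Fin (t + 1)) = Fin.castSucc ⟨u, hlt⟩ from rfl, Fin.snoc_castSucc,
          hslt u hlt]
      · obtain rfl : u = ⟨t, ht⟩ := Fin.ext heq
        rw [show (⟨t, hu⟩ : Fin (t + 1)) = Fin.last t from rfl, Fin.snoc_last, hst]
    ext ω
    exact ⟨fun hω u hu => (hω u (Nat.lt_succ_iff.1 hu)).trans (hsnoc u hu).symm,
      fun hω u hu => (hω u (Nat.lt_succ_iff.2 hu)).trans (hsnoc u _)⟩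
  have e2 : {ω | ∀ u < (⟨t, ht⟩ : Fin c), S u ω = s u} =
      {ω | ∀ (u : Fin c) (h : (u : ℕ) < t), S u ω = σ ⟨u, h⟩} := by
    ext ω
    exact ⟨fun hω u hu => (hω u hu).trans (hslt u hu),
      fun hω u hu => (hω u hu).trans (hslt u hu).symm⟩
  rw [e1, e2] at hlaw
  exact hlaw

variable [MeasurableSpace κ] [MeasurableSingletonClass κ]

theorem SampledWithReplacement.measureReal_draws_eq
    (h : SampledWithReplacement μ p S) (s : Fin c → κ) :
    μ.real {ω | ∀ t, S t ω = s t} = ∏ t, p (s t) := by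
  have h1 := h.indep.measure_inter_preimage_eq_mul Finset.univ (sets := fun t => {s t})
    fun t _ => measurableSet_singleton _
  have hset : {ω | ∀ t, S t ω = s t} = ⋂ t ∈ (Finset.univ : Finset (Fin c)), S t ⁻¹' {s t} := by
    ext ω
    simp
  rw [hset, Measure.real, h1, ENNReal.toReal_prod]
  exact Finset.prod_congr rfl fun t _ => h.law t (s t)

variable [Fintype κ] [IsProbabilityMeasure μ]

theorem measureReal_eq_sum_inter_preimage {f : Ω → κ} (hf : Measurable f) (E : Set Ω) :
    μ.real E = ∑ k, μ.real {ω | ω ∈ E ∧ f ω = k} := by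
  have h := sum_measureReal_preimage_singleton (μ := μ.restrict E) (f := f) Finset.univ
    fun k _ => hf (measurableSet_singleton k)
  rw [Finset.coe_univ, Set.preimage_univ, measureReal_restrict_apply_univ] at h
  rw [← h]
  refine Finset.sum_congr rfl fun k _ => ?_
  rw [measureReal_restrict_apply (hf (measurableSet_singleton k))]
  congr 1
  ext ω
  exact and_comm

open Classical in
theorem measureReal_draws_mem (hS : ∀ t, Measurable (S t)) (B : Set (Fin c → κ)) :
    μ.real {ω | (fun t => S t ω) ∈ B} =
      ∑ s, μ.real {ω | ∀ t, S t ω = s t} * B.indicator 1 s := by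
  have hf : Measurable fun ω t => S t ω := measurable_pi_lambda _ hS
  have h := sum_measureReal_preimage_singleton (μ := μ) (Finset.univ.filter (· ∈ B))
    fun s _ => hf (measurableSet_singleton s)
  have hset : {ω | (fun t => S t ω) ∈ B} =
      (fun ω t => S t ω) ⁻¹' ((Finset.univ.filter (· ∈ B) : Finset (Fin c → κ)) : Set _) := by
    ext ω
    simp
  rw [hset, ← h, Finset.sum_filter]
  refine Finset.sum_congr rfl fun s _ => ?_
  have hs : (fun ω t => S t ω) ⁻¹' {s} = {ω | ∀ t, S t ω = s t} := by
    ext ω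
    simp [funext_iff]
  rw [hs]
  by_cases h : s ∈ B <;> simp [h]

theorem sum_prefixProb_snoc (hS : ∀ t, Measurable (S t)) {t : ℕ} (ht : t < c) (σ : Fin t → κ) :
    ∑ k, prefixProb μ S (t + 1) (Fin.snoc σ k : Fin (t + 1) → κ) = prefixProb μ S t σ := by
  rw [prefixProb, measureReal_eq_sum_inter_preimage (hS ⟨t, ht⟩)]
  refine Finset.sum_congr rfl fun k _ => ?_
  rw [prefixProb]
  congr 1
  ext ω
  constructor
  · intro h
    refine ⟨fun u hu => ?_, ?_⟩
    · have := h u (by omega)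
      rwa [show (⟨u, by omega⟩ : Fin (t + 1)) = Fin.castSucc ⟨u, hu⟩ from rfl,
        Fin.snoc_castSucc] at this
    · have := h ⟨t, ht⟩ (Nat.lt_succ_self t)
      rwa [show (⟨t, Nat.lt_succ_self t⟩ : Fin (t + 1)) = Fin.last t from rfl,
        Fin.snoc_last] at this
  · rintro ⟨h1, h2⟩ u hu
    rcases Nat.lt_succ_iff_lt_or_eq.1 hu with hlt | heq
    · rw [show (⟨u, hu⟩ : Fin (t + 1)) = Fin.castSucc ⟨u, hlt⟩ from rfl, Fin.snoc_castSucc]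
      exact h1 u hlt
    · obtain rfl : u = ⟨t, ht⟩ := Fin.ext heq
      rw [show (⟨t, hu⟩ : Fin (t + 1)) = Fin.last t from rfl, Fin.snoc_last]
      exact h2

variable [DecidableEq κ]

/-- The mean loss after `t` draws without replacement followed by `m` independent ones does not
decrease when one more draw is made independently. -/
theorem SampledWithoutReplacement.sum_prefixProb_mul_drawMean_le
    (h : SampledWithoutReplacement μ p S) (hS : ∀ t, Measurable (S t)) (hp : ∀ k, 0 ≤ p k)
    (hp1 : ∑ k, p k = 1) {b : Finset κ → ℝ} (hb : Antitone b) {t : ℕ} (ht : t < c) (m : ℕ) :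
    ∑ σ : Fin (t + 1) → κ, prefixProb μ S (t + 1) σ * drawMean p b m (Finset.univ.image σ) ≤
      ∑ σ : Fin t → κ, prefixProb μ S t σ * drawMean p b (m + 1) (Finset.univ.image σ) := by
  rw [← (Fin.snocEquiv fun _ => κ).sum_comp, Fintype.sum_prod_type, Finset.sum_comm]
  refine Finset.sum_le_sum fun σ _ => ?_
  change ∑ k, prefixProb μ S (t + 1) (Fin.snoc σ k : Fin (t + 1) → κ) *
    drawMean p b m (Finset.univ.image (Fin.snoc σ k : Fin (t + 1) → κ)) ≤ _
  have himage : ∀ k, Finset.univ.image (Fin.snoc σ k : Fin (t + 1) → κ) =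
      insert k (Finset.univ.image σ) := by
    intro k
    ext x
    simp only [Finset.mem_insert, Finset.mem_image, Finset.mem_univ, true_and,
      Fin.exists_fin_succ', Fin.snoc_castSucc, Fin.snoc_last]
    rw [or_comm, eq_comm]
  simp only [himage]
  have hsum := sum_prefixProb_snoc (μ := μ) hS ht σ
  have hnn : ∀ k, 0 ≤ prefixProb μ S (t + 1) (Fin.snoc σ k : Fin (t + 1) → κ) :=
    fun k => measureReal_nonneg
  by_cases hσ : Function.Injective σ
  · refine sum_mul_drawMean_insert_le hp hp1 hb m _ hnn hsum (fun k hk => ?_) fun k hk => ?_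
    · obtain ⟨u, -, hu⟩ := Finset.mem_image.1 hk
      refine h.prefixProb_eq_zero (Nat.succ_le_of_lt ht) fun hinj => ?_
      have := hinj (a₁ := Fin.castSucc u) (a₂ := Fin.last t) (by
        rw [Fin.snoc_castSucc, Fin.snoc_last, hu])
      exact (Fin.castSucc_lt_last u).ne this
    · rw [Finset.sum_image fun u _ v _ huv => hσ huv]
      exact h.prefixProb_snoc ht σ fun u hu =>
        hk (Finset.mem_image.2 ⟨u, Finset.mem_univ u, hu⟩)
  · -- Prefixes with a repetition have probability zero, and so have their continuations.
    have h0 := h.prefixProb_eq_zero ht.le hσ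
    rw [h0] at hsum ⊢
    have hz := (Finset.sum_eq_zero_iff_of_nonneg fun k _ => hnn k).1 hsum
    rw [zero_mul, Finset.sum_eq_zero fun k hk => by rw [hz k hk, zero_mul]]

/-- Draws without replacement cover more than independent draws: a property of the set of outcomes
that is inherited by subsets is at most as likely. -/
theorem SampledWithoutReplacement.measureReal_le_expect
    (h : SampledWithoutReplacement μ p S) (hS : ∀ t, Measurable (S t)) (hp : ∀ k, 0 ≤ p k)
    (hp1 : ∑ k, p k = 1) {Bad : Finset κ → Prop} (hBad : ∀ T T', T ⊆ T' → Bad T' → Bad T) :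
    μ.real {ω | Bad (Finset.univ.image fun t => S t ω)} ≤
      expect p ({s : Fin c → κ | Bad (Finset.univ.image s)}.indicator 1) := by
  set b : Finset κ → ℝ := {T | Bad T}.indicator 1 with hb
  have hanti : Antitone b := by
    intro T T' hT
    by_cases h' : Bad T'
    · rw [hb, Set.indicator_of_mem (show T ∈ {T | Bad T} from hBad T T' hT h'),
        Set.indicator_of_mem (show T' ∈ {T | Bad T} from h')]
      rfl
    · rw [hb, Set.indicator_of_notMem (show T' ∉ {T | Bad T} from h')]
      exact Set.indicator_nonneg (fun _ _ => zero_le_one) _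
  have hstep : ∀ t, t ≤ c →
      ∑ σ : Fin t → κ, prefixProb μ S t σ * drawMean p b (c - t) (Finset.univ.image σ) ≤
        drawMean p b c ∅ := by
    intro t
    induction t with
    | zero =>
      intro _
      rw [Fintype.sum_unique, tsub_zero, prefixProb]
      simp
    | succ t ih =>
      intro ht
      refine le_trans ?_ (ih (by omega))
      have := h.sum_prefixProb_mul_drawMean_le hS hp hp1 hanti (Nat.lt_of_succ_le ht) (c - (t + 1))
      rwa [show c - (t + 1) + 1 = c - t by omega] at this
  have hfin := hstep c le_rfl
  rw [drawMean_eq_expect, tsub_self] at hfin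
  simp only [Finset.empty_union] at hfin
  refine le_trans (le_of_eq ?_) hfin
  refine (measureReal_draws_mem hS {s | Bad (Finset.univ.image s)}).trans ?_
  refine Finset.sum_congr rfl fun s _ => ?_
  refine congrArg₂ (· * ·) (congrArg μ.real ?_) rfl
  ext ω
  exact ⟨fun hω u _ => hω u, fun hω u => hω u u.2⟩

theorem SampledWithReplacement.measureReal_eq_expect
    (h : SampledWithReplacement μ p S) (hS : ∀ t, Measurable (S t)) (Bad : Finset κ → Prop) :
    μ.real {ω | Bad (Finset.univ.image fun t => S t ω)} =
      expect p ({s : Fin c → κ | Bad (Finset.univ.image s)}.indicator 1) := by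
  refine (measureReal_draws_mem hS {s | Bad (Finset.univ.image s)}).trans ?_
  exact Finset.sum_congr rfl fun s _ => by rw [h.measureReal_draws_eq]

end Law

/-! ### Projection onto sampled columns -/

section Columns

variable {a c : ℕ} {κ : Type*} {β : ℝ} {A : Matrix (Fin a) κ ℂ} {p : κ → ℝ}

/-- The entries of a matrix, as a vector with the Euclidean norm. -/
def entries (M : Matrix (Fin a) (Fin a) ℂ) : EuclideanSpace ℂ (Fin a × Fin a) :=
  WithLp.toLp 2 fun q => M q.1 q.2

theorem norm_entries (M : Matrix (Fin a) (Fin a) ℂ) : ‖entries M‖ = √(sqNorm M) := by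
  rw [EuclideanSpace.norm_eq, Fintype.sum_prod_type]
  rfl

/-- The rank-one matrix `(A e_k) (A e_k)ᴴ / p_k`, an unbiased estimate of `A Aᴴ`, as a vector of
entries. -/
noncomputable def outerSample (A : Matrix (Fin a) κ ℂ) (p : κ → ℝ) (k : κ) :
    EuclideanSpace ℂ (Fin a × Fin a) :=
  WithLp.toLp 2 fun q => A q.1 k * star (A q.2 k) / p k

theorem norm_outerSample (hp : ∀ k, 0 ≤ p k) (k : κ) :
    ‖outerSample A p k‖ = (∑ i, ‖A i k‖ ^ 2) / p k := by
  rw [EuclideanSpace.norm_eq]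
  have : ∑ q, ‖(outerSample A p k) q‖ ^ 2 = ((∑ i, ‖A i k‖ ^ 2) / p k) ^ 2 := by
    rw [div_pow, sq (∑ i, ‖A i k‖ ^ 2), Finset.sum_mul_sum, Finset.sum_div,
      Fintype.sum_prod_type]
    refine Finset.sum_congr rfl fun i _ => ?_
    rw [Finset.sum_div]
    refine Finset.sum_congr rfl fun j _ => ?_
    simp only [outerSample, norm_div, norm_mul, norm_star, Complex.norm_real, Real.norm_eq_abs,
      div_pow, mul_pow, sq_abs]
  rw [this, Real.sqrt_sq (div_nonneg (Finset.sum_nonneg fun _ _ => by positivity) (hp k))]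

variable [Fintype κ]

theorem IsColumnNormDistribution.mul_le (h : IsColumnNormDistribution β A p) (hA : 0 < sqNorm A)
    (k : κ) : β * ∑ i, ‖A i k‖ ^ 2 ≤ p k * sqNorm A := by
  have h1 := h.lower_bound k
  rw [← mul_div_assoc] at h1
  exact (div_le_iff₀ hA).1 h1

theorem IsColumnNormDistribution.apply_eq_zero (h : IsColumnNormDistribution β A p) (hβ : 0 < β)
    (hA : 0 < sqNorm A) {k : κ} (hk : p k = 0) (i : Fin a) : A i k = 0 := by
  have h1 := h.mul_le hA k
  rw [hk, zero_mul] at h1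
  have h2 : ∑ i, ‖A i k‖ ^ 2 ≤ 0 := nonpos_of_mul_nonpos_right h1 hβ
  have h3 := (Finset.single_le_sum (f := fun i => ‖A i k‖ ^ 2) (fun _ _ => by positivity)
    (Finset.mem_univ i)).trans h2
  exact norm_eq_zero.1 (pow_eq_zero_iff two_ne_zero |>.1 (le_antisymm h3 (by positivity)))

theorem IsColumnNormDistribution.sum_smul_outerSample (h : IsColumnNormDistribution β A p)
    (hβ : 0 < β) (hA : 0 < sqNorm A) :
    ∑ k, (p k : ℂ) • outerSample A p k = entries (A * Aᴴ) := by
  ext q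
  simp only [outerSample, entries, WithLp.ofLp_sum, WithLp.ofLp_smul, Finset.sum_apply, Pi.smul_apply,
    smul_eq_mul, Matrix.mul_apply, Matrix.conjTranspose_apply]
  refine Finset.sum_congr rfl fun k _ => ?_
  by_cases hk : p k = 0
  · rw [h.apply_eq_zero hβ hA hk, hk]
    simp
  · rw [mul_div_cancel₀]
    exact_mod_cast hk

theorem norm_sum_outerSample_sub (hc : 0 < c) (s : Fin c → κ) :
    ‖∑ t, (outerSample A p (s t) - entries (A * Aᴴ))‖ =
      c * √(sqNorm (A * Aᴴ - columns A s *
        Matrix.diagonal (fun t => ((c : ℂ) * p (s t))⁻¹) * (columns A s)ᴴ)) := by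
  have hc' : (c : ℂ) ≠ 0 := by exact_mod_cast hc.ne'
  have h : ∑ t, (outerSample A p (s t) - entries (A * Aᴴ)) =
      -((c : ℂ) • entries (A * Aᴴ - columns A s *
        Matrix.diagonal (fun t => ((c : ℂ) * p (s t))⁻¹) * (columns A s)ᴴ)) := by
    rw [Finset.sum_sub_distrib, Finset.sum_const, Finset.card_univ, Fintype.card_fin,
      ← Nat.cast_smul_eq_nsmul ℂ]
    ext q
    simp only [entries, outerSample, WithLp.ofLp_sub, WithLp.ofLp_sum, WithLp.ofLp_smul,
      WithLp.ofLp_neg, Pi.sub_apply, Pi.neg_apply, Pi.smul_apply, Finset.sum_apply, smul_eq_mul,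
      Matrix.sub_apply, mul_sub, neg_sub]
    congr 1
    rw [Matrix.mul_apply (M := columns A s * _), Finset.mul_sum]
    refine Finset.sum_congr rfl fun t _ => ?_
    rw [Matrix.mul_diagonal, mul_inv, div_eq_mul_inv, Matrix.conjTranspose_apply]
    simp only [columns, Matrix.submatrix_apply, id]
    field_simp
  rw [h, norm_neg, norm_smul, norm_entries, Complex.norm_natCast]

/-- Some matrix `A Y` with `Y` supported on the rows in `T`, that is, with columns in the span of
the columns of `A` indexed by `T`, is within squared distance `e` of `A`. Unlike the projection
onto sampled columns, this depends only on the set of columns, and is monotone in it. -/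
def ApproxByColumns (A : Matrix (Fin a) κ ℂ) (e : ℝ) (T : Finset κ) : Prop :=
  ∃ Y : Matrix κ κ ℂ, (∀ k ∉ T, ∀ j, Y k j = 0) ∧ sqNorm (A - A * Y) ≤ e

theorem ApproxByColumns.mono {A : Matrix (Fin a) κ ℂ} {e : ℝ} {T T' : Finset κ} (hT : T ⊆ T')
    (h : ApproxByColumns A e T) : ApproxByColumns A e T' := by
  obtain ⟨Y, hY, hle⟩ := h
  exact ⟨Y, fun k hk => hY k fun hkT => hk (hT hkT), hle⟩

variable [DecidableEq κ]

theorem tailSq_nonneg (A : Matrix (Fin a) κ ℂ) (r : ℕ) : 0 ≤ tailSq A r :=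
  Finset.sum_nonneg fun _ _ => sq_nonneg _

/-- Projection onto sampled columns `C` is controlled by how well `A Aᴴ` is approximated by a
combination `C D Cᴴ` of them. -/
theorem sqNorm_sub_mul_pinv_le (A : Matrix (Fin a) κ ℂ) (r : ℕ) (C : Matrix (Fin a) (Fin c) ℂ)
    (D : Matrix (Fin c) (Fin c) ℂ) :
    sqNorm (A - C * pinv C * A) ≤
      tailSq A r + 2 * √r * √(sqNorm (A * Aᴴ - C * D * Cᴴ)) := by
  obtain ⟨U, hU, hUr, hUA⟩ := exists_isProj_sqNorm_sub_le_tailSq A r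
  have hP := isProj_mul_pinv C
  have hPC : C * pinv C * C = C := (pinv_spec C).1
  have hCP : Cᴴ * (C * pinv C) = Cᴴ := by
    rw [← hP.herm, ← Matrix.conjTranspose_mul, hPC]
  have h := sqNorm_sub_le_of_approx hU hP A (N := C * D * Cᴴ)
    (by rw [← Matrix.mul_assoc, ← Matrix.mul_assoc, hPC]) (by rw [Matrix.mul_assoc, hCP])
  refine h.trans (add_le_add hUA ?_)
  gcongr

theorem approxByColumns_image_iff (A : Matrix (Fin a) κ ℂ) (e : ℝ) (s : Fin c → κ) :
    ApproxByColumns A e (Finset.univ.image s) ↔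
      sqNorm (A - columns A s * pinv (columns A s) * A) ≤ e := by
  set C := columns A s with hC
  constructor
  · rintro ⟨Y, hY, hle⟩
    refine ((isProj_mul_pinv C).sqNorm_sub_mul_le_of_mul_eq A ?_).trans hle
    have hPA : ∀ i t, (C * pinv C * A) i (s t) = A i (s t) := by
      intro i t
      have := congrFun (congrFun (pinv_spec C).1 i) t
      rw [Matrix.mul_apply] at this ⊢
      exact this
    rw [← Matrix.mul_assoc]
    ext i j
    rw [Matrix.mul_apply, Matrix.mul_apply]
    refine Finset.sum_congr rfl fun k _ => ?_
    by_cases hk : k ∈ Finset.univ.image s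
    · obtain ⟨t, -, rfl⟩ := Finset.mem_image.1 hk
      rw [hPA]
    · rw [hY k hk, mul_zero, mul_zero]
  · intro h
    refine ⟨(Matrix.of fun k t => if k = s t then 1 else 0 : Matrix κ (Fin c) ℂ) * (pinv C * A), fun k hk j => ?_, ?_⟩
    · rw [Matrix.mul_apply]
      refine Finset.sum_eq_zero fun t _ => ?_
      have : k ≠ s t := fun h => hk (Finset.mem_image.2 ⟨t, Finset.mem_univ t, h.symm⟩)
      simp [this]
    · have hA : A * (Matrix.of fun k t => if k = s t then 1 else 0 : Matrix κ (Fin c) ℂ) = C := by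
        ext i t
        simp [Matrix.mul_apply, hC, columns]
      rwa [← Matrix.mul_assoc, hA, ← Matrix.mul_assoc]

/-- Independent column sampling: outside an event of probability `δ`, the deviation of the
empirical mean of `(A e_k) (A e_k)ᴴ / p_k` from `A Aᴴ` is small enough for the projection onto the
sampled columns to lose at most `ε ‖A‖²` against the best approximation of rank `r`. -/
theorem IsColumnNormDistribution.expect_not_approxByColumns_le
    (h : IsColumnNormDistribution β A p) {δ ε η : ℝ} {r : ℕ} (hβ : 0 < β) (hδ₀ : 0 < δ)
    (hδ₁ : δ < 1) (hε : 0 < ε) (hη : η = 1 + √(8 / β * Real.log (1 / δ)))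
    (hc : 4 * η ^ 2 * (r : ℝ) / (β * ε ^ 2) ≤ (c : ℝ)) :
    expect p ({s : Fin c → κ | ¬ ApproxByColumns A (tailSq A r + ε * sqNorm A)
      (Finset.univ.image s)}.indicator 1) ≤ δ := by
  have hη1 : 1 ≤ η := by rw [hη]; linarith [Real.sqrt_nonneg (8 / β * Real.log (1 / δ))]
  have htriv : (∀ s : Fin c → κ, ApproxByColumns A (tailSq A r + ε * sqNorm A)
      (Finset.univ.image s)) → expect p ({s : Fin c → κ | ¬ ApproxByColumns A
        (tailSq A r + ε * sqNorm A) (Finset.univ.image s)}.indicator 1) ≤ δ := by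
    intro hall
    have : {s : Fin c → κ | ¬ ApproxByColumns A (tailSq A r + ε * sqNorm A)
        (Finset.univ.image s)} = ∅ := Set.eq_empty_of_forall_notMem fun s hs => hs (hall s)
    rw [this, Set.indicator_empty]
    simpa [expect] using hδ₀.le
  rcases (sqNorm_nonneg A).eq_or_lt with hA | hA
  · refine htriv fun s => ?_
    rw [approxByColumns_image_iff]
    have := (isProj_mul_pinv (columns A s)).sqNorm_sub A
    linarith [sqNorm_nonneg (columns A s * pinv (columns A s) * A), tailSq_nonneg A r,
      mul_nonneg hε.le (sqNorm_nonneg A)]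
  rcases Nat.eq_zero_or_pos r with rfl | hr
  · refine htriv fun s => ?_
    rw [approxByColumns_image_iff]
    have := sqNorm_sub_mul_pinv_le A 0 (columns A s) 0
    simp only [Nat.cast_zero, Real.sqrt_zero, mul_zero, zero_mul, add_zero] at this
    linarith [mul_nonneg hε.le hA.le]
  have hr' : (0 : ℝ) < r := by exact_mod_cast hr
  have hc' : (0 : ℝ) < c := lt_of_lt_of_le (by positivity) hc
  have hc0 : 0 < c := by exact_mod_cast hc'
  have hmain := expect_indicator_norm_sum_le (𝕜 := ℂ) h.nonneg h.sum_eq_one (outerSample A p)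
    (h.sum_smul_outerSample hβ hA) hβ hA hδ₀ hδ₁
    (fun k => by
      rw [norm_outerSample h.nonneg]
      rcases (h.nonneg k).eq_or_lt with hk | hk
      · -- A column of probability zero vanishes, in agreement with the junk value `_ / 0 = 0`.
        rw [← hk, div_zero]
        positivity
      · rw [div_le_div_iff₀ hk hβ]
        linarith [h.mul_le hA k])
    (by
      rw [sqNorm, Finset.sum_comm]
      refine Finset.sum_le_sum fun k _ => ?_
      rw [norm_outerSample h.nonneg]
      rcases eq_or_ne (p k) 0 with hk | hk
      · rw [hk, zero_mul]
        exact Finset.sum_nonneg fun _ _ => by positivity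
      · rw [mul_div_cancel₀ _ hk])
    hc0
  refine (expect_mono h.nonneg fun s => ?_).trans hmain
  refine Set.indicator_le_indicator_of_subset (fun s hs => ?_) (fun _ => zero_le_one) s
  rw [Set.mem_ofPred_eq] at hs ⊢
  by_contra hle
  rw [not_lt, norm_sum_outerSample_sub hc0, ← hη] at hle
  refine hs ((approxByColumns_image_iff _ _ _).2 ?_)
  refine (sqNorm_sub_mul_pinv_le A r (columns A s)
    (Matrix.diagonal fun t => ((c : ℂ) * p (s t))⁻¹)).trans (add_le_add le_rfl ?_)
  set q := √(sqNorm (A * Aᴴ - columns A s *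
    Matrix.diagonal (fun t => ((c : ℂ) * p (s t))⁻¹) * (columns A s)ᴴ)) with hq
  -- The choice of `c`: `2 √r η √(c / β) ≤ ε c`.
  have hkey : 2 * √r * (η * √(c / β)) ≤ ε * c := by
    refine abs_le_of_sq_le_sq' ?_ (by positivity) |>.2
    rw [mul_pow, mul_pow, mul_pow, Real.sq_sqrt hr'.le, Real.sq_sqrt (by positivity), mul_pow]
    rw [div_le_iff₀ (by positivity)] at hc
    rw [← mul_div_assoc, ← mul_div_assoc, div_le_iff₀ hβ]
    nlinarith [mul_le_mul_of_nonneg_right hc hc'.le]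
  refine le_of_mul_le_mul_left ?_ hc'
  calc c * (2 * √r * q) = 2 * √r * (c * q) := by ring
    _ ≤ 2 * √r * (η * (sqNorm A * √(c / β))) := by gcongr
    _ = 2 * √r * (η * √(c / β)) * sqNorm A := by ring
    _ ≤ ε * c * sqNorm A := by gcongr
    _ = c * (ε * sqNorm A) := by ring

theorem IsColumnNormDistribution.measureReal_not_sqNorm_le [MeasurableSpace κ]
    [MeasurableSingletonClass κ] {Ω : Type*} [MeasurableSpace Ω] {μ : Measure Ω}
    [IsProbabilityMeasure μ] (h : IsColumnNormDistribution β A p) {δ ε η : ℝ} {r : ℕ} (hβ : 0 < β)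
    (hδ₀ : 0 < δ) (hδ₁ : δ < 1) (hε : 0 < ε) (hη : η = 1 + √(8 / β * Real.log (1 / δ)))
    (hc : 4 * η ^ 2 * (r : ℝ) / (β * ε ^ 2) ≤ (c : ℝ)) {S : Fin c → Ω → κ}
    (hS : ∀ t, Measurable (S t))
    (hlaw : SampledWithReplacement μ p S ∨ SampledWithoutReplacement μ p S) :
    μ.real {ω | ¬ sqNorm (A - columns A (fun t => S t ω) * pinv (columns A fun t => S t ω) * A) ≤
      tailSq A r + ε * sqNorm A} ≤ δ := by
  simp only [← approxByColumns_image_iff]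
  refine le_trans ?_ (h.expect_not_approxByColumns_le hβ hδ₀ hδ₁ hε hη hc)
  rcases hlaw with hlaw | hlaw
  · exact (hlaw.measureReal_eq_expect hS
      fun T => ¬ ApproxByColumns A (tailSq A r + ε * sqNorm A) T).le
  · exact hlaw.measureReal_le_expect hS h.nonneg h.sum_eq_one
      (Bad := fun T => ¬ ApproxByColumns A (tailSq A r + ε * sqNorm A) T)
      fun T T' hT hbad hgood => hbad (hgood.mono hT)

end Columns

/-! ### Projecting all modes of a tensor -/

section Tensors

variable {d : ℕ} {I : Fin d → ℕ}

theorem frob_sq_eq_sqNorm_unfold (X : Tensor I) (n : Fin d) :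
    frob X ^ 2 = sqNorm (unfold X n) := by
  rw [frob, Real.sq_sqrt (Finset.sum_nonneg fun _ _ => by positivity),
    ← Equiv.sum_comp (Equiv.piSplitAt n fun k => Fin (I k)).symm, Fintype.sum_prod_type]
  rfl

theorem unfold_modeProducts_update_one (X : Tensor I) (n : Fin d)
    (P : Matrix (Fin (I n)) (Fin (I n)) ℂ) :
    unfold (modeProducts X (Function.update (fun _ => 1) n P)) n = P * unfold X n := by
  rw [unfold_modeProducts, Function.update_self]
  convert Matrix.mul_one _
  ext j i
  rw [Matrix.of_apply, Matrix.one_apply]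
  have : ∀ m : {j : Fin d // j ≠ n},
      (Function.update (fun k => (1 : Matrix (Fin (I k)) (Fin (I k)) ℂ)) n P) m (i m) (j m) =
        if i m = j m then 1 else 0 := by
    intro m
    rw [Function.update_of_ne m.2, Matrix.one_apply]
  simp only [this]
  rw [Finset.prod_ite_zero]
  simp [funext_iff, eq_comm]

theorem modeProducts_one (X : Tensor I) : modeProducts X (fun _ => 1) = X := by
  funext i
  rw [modeProducts, Finset.sum_eq_single i]
  · simp
  · intro j _ hj
    obtain ⟨n, hn⟩ := Function.ne_iff.1 hj
    have h0 : (1 : Matrix (Fin (I n)) (Fin (I n)) ℂ) (i n) (j n) = 0 := Matrix.one_apply_ne hn.symm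
    exact mul_eq_zero_of_right _ (Finset.prod_eq_zero (Finset.mem_univ n) h0)
  · simp

/-- Projecting in one more mode adds at most the residual of that mode, as the new residual and the
projected old one are orthogonal. -/
theorem frob_sub_modeProducts_sq_le (X : Tensor I) {P : (n : Fin d) → Matrix (Fin (I n)) (Fin (I n)) ℂ}
    (hP : ∀ n, IsProj (P n)) :
    frob (X - modeProducts X P) ^ 2 ≤ ∑ n, sqNorm (unfold X n - P n * unfold X n) := by
  have h : ∀ s : Finset (Fin d), frob (X - modeProducts X fun n => if n ∈ s then P n else 1) ^ 2 ≤
      ∑ n ∈ s, sqNorm (unfold X n - P n * unfold X n) := by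
    intro s
    induction s using Finset.induction_on with
    | empty =>
      simp only [Finset.notMem_empty, if_false, modeProducts_one, sub_self, Finset.sum_empty]
      simp [frob]
    | insert n s hn ih =>
      set Y := modeProducts X fun m => if m ∈ s then P m else 1 with hY
      have hstep : (modeProducts X fun m => if m ∈ insert n s then P m else 1) =
          modeProducts Y (Function.update (fun _ => 1) n (P n)) := by
        rw [hY, modeProducts_modeProducts]
        congr 1
        funext m
        by_cases hm : m = n
        · subst hm
          simp [hn]
        · simp [hm]
      rw [hstep, frob_sq_eq_sqNorm_unfold _ n, Finset.sum_insert hn]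
      rw [frob_sq_eq_sqNorm_unfold _ n] at ih
      have := (hP n).sqNorm_sub_mul_le (unfold X n) (unfold Y n)
      rw [← unfold_modeProducts_update_one] at this
      exact this.trans (add_le_add le_rfl ih)
  simpa using h Finset.univ

end Tensors

end HOID

theorem mainTheorem6 {d : ℕ} (I : Fin d → ℕ) (X : HOID.Tensor I) (r c : Fin d → ℕ)
    (β δ ε η : ℝ) (hβ₀ : 0 < β) (hβ₁ : β ≤ 1) (hδ₀ : 0 < δ) (hδ₁ : δ < 1) (hε : 0 < ε)
    (hη : η = 1 + √(8 / β * Real.log (1 / δ)))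
    (hc : ∀ n, 4 * η ^ 2 * (r n : ℝ) / (β * ε ^ 2) ≤ (c n : ℝ))
    (p : (n : Fin d) → HOID.Col I n → ℝ)
    (hp : ∀ n, HOID.IsColumnNormDistribution β (HOID.unfold X n) (p n))
    {Ω : Type*} [MeasurableSpace Ω] (μ : MeasureTheory.Measure Ω)
    [MeasureTheory.IsProbabilityMeasure μ]
    (S : (n : Fin d) → Fin (c n) → Ω → HOID.Col I n) (hS : ∀ n t, Measurable (S n t))
    (hlaw : ∀ n, HOID.SampledWithReplacement μ (p n) (S n) ∨
      HOID.SampledWithoutReplacement μ (p n) (S n))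
    (C : Ω → (n : Fin d) → Matrix (Fin (I n)) (Fin (c n)) ℂ)
    (hC : ∀ ω n, C ω n = HOID.columns (HOID.unfold X n) fun t => S n t ω) :
    μ.real {ω | ¬ HOID.frob (X - HOID.modeProducts (HOID.coreTensor X (C ω)) (C ω)) ^ 2 ≤
        ∑ n, HOID.tailSq (HOID.unfold X n) (r n) + (d : ℝ) * ε * HOID.frob X ^ 2} ≤
      (d : ℝ) * δ := by
  have hmode : ∀ n, μ.real {ω | ¬ HOID.sqNorm
      (HOID.unfold X n - C ω n * HOID.pinv (C ω n) * HOID.unfold X n) ≤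
        HOID.tailSq (HOID.unfold X n) (r n) + ε * HOID.sqNorm (HOID.unfold X n)} ≤ δ := by
    intro n
    simp only [hC]
    exact (hp n).measureReal_not_sqNorm_le hβ₀ hδ₀ hδ₁ hε hη (hc n) (hS n) (hlaw n)
  calc _ ≤ μ.real (⋃ n, {ω | ¬ HOID.sqNorm
          (HOID.unfold X n - C ω n * HOID.pinv (C ω n) * HOID.unfold X n) ≤
        HOID.tailSq (HOID.unfold X n) (r n) + ε * HOID.sqNorm (HOID.unfold X n)}) := by
        refine MeasureTheory.measureReal_mono fun ω hω => ?_
        by_contra hgood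
        rw [Set.mem_iUnion, not_exists] at hgood
        refine hω ?_
        -- The reconstruction multiplies mode `n` by the projection `Cₙ Cₙ†`.
        rw [HOID.coreTensor, HOID.modeProducts_modeProducts]
        refine (HOID.frob_sub_modeProducts_sq_le X fun n => HOID.isProj_mul_pinv (C ω n)).trans ?_
        refine (Finset.sum_le_sum fun n _ => not_not.1 (hgood n)).trans (le_of_eq ?_)
        rw [Finset.sum_add_distrib]
        simp only [← HOID.frob_sq_eq_sqNorm_unfold]
        rw [Finset.sum_const, Finset.card_univ, Fintype.card_fin, nsmul_eq_mul, mul_assoc]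
    _ ≤ ∑ _n : Fin d, δ := (MeasureTheory.measureReal_iUnion_fintype_le _).trans
        (Finset.sum_le_sum fun n _ => hmode n)
    _ = d * δ := by rw [Finset.sum_const, Finset.card_univ, Fintype.card_fin, nsmul_eq_mul]
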